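/- Let $q_1,q_2\ge 1$ be coprime integers, $Q=q_1q_2$, and let $V:\mathbb{Z}^2\to\mathbb{C}$ be periodic with respect to $q_1\mathbb{Z}\oplus q_2\mathbb{Z}$, with average $[V]=\frac1Q\sum_{n\in W}V(n)$ over the cell $W=\{n\in\mathbb{Z}^2:0\le n_j\le q_j-1\}$. Let $(\Delta u)(n)=\sum_{\|n'-n\|_1=1}u(n')$ be the discrete Laplacian. Let $\mathcal{D}(z)$ be the $Q\times Q$ matrix by which $-\Delta+V$ acts on $\{u(n)\}_{n\in W}$ when $u$ is extended to $\mathbb{Z}^2$ by $u(n+q_j\mathbf{e}_j)=z_ju(n)$, $j=1,2$, and let $\mathcal{P}(z,\lambda)=\det(\mathcal{D}(z)-\lambda I)$, a Laurent polynomial in $z=(z_1,z_2)$ for each $\lambda\in\mathbb{C}$. A Laurent polynomial is a monomial if it has the form $Cz_1^{a_1}z_2^{a_2}$ with $C\in\mathbb{C}\setminus\{0\}$, $a\in\mathbb{Z}^2$. It is called irreducible if it is not a product of two non-monomial Laurent polynomials, and reducible otherwise. A factor is non-trivial if it is not a monomial; factors that differ by multiplication by a monomial are identified. Theorem. (1)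 For every $\lambda\in\mathbb{C}$ with $\lambda\neq[V]$, $\mathcal{P}(z,\lambda)$ is irreducible as a Laurent polynomial in $z$. (2) If $\mathcal{P}(z,[V])$ is reducible, then it has exactly two distinct non-trivial irreducible factors $f$ and $g$, each of multiplicity one. With $\rho^j_{n}=e^{2\pi i n/q_j}$, they are (up to monomials) the Laurent polynomials determined by $$f(z_1^{q_1},z_2^{q_2})=\prod_{\substack{0\le n_1\le q_1-1\\0\le n_2\le q_2-1}}\left(\frac{z_2}{\rho^1_{n_1}}+\frac{z_1}{\rho^2_{n_2}}\right),\qquad g(z_1^{q_1},z_2^{q_2})=\prod_{\substack{0\le n_1\le q_1-1\\0\le n_2\le q_2-1}}\left(\frac{1}{\rho^1_{n_1}}+\rho^2_{n_2}z_1z_2\right),$$ and there is a constant $K\neq0$ such that $$(-1)^{Q}\,\mathcal{P}(z_1^{q_1},z_2^{q_2},[V])=\frac{K}{z_1^{Q}z_2^{Q}}\prod_{\substack{0\le n_1\le q_1-1\\0\le n_2\le q_2-1}}\left(\frac{z_2}{\rho^1_{n_1}}+\frac{z_1}{\rho^2_{n_2}}\right)\prod_{\substack{0\le n_1\le q_1-1\\0\le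 n_2\le q_2-1}}\left(\frac{1}{\rho^1_{n_1}}+\rho^2_{n_2}z_1z_2\right).$$ -/

import Mathlib

noncomputable section

namespace FermiVariety

/-- Complex Laurent polynomials in the variables `z_0, …, z_{d-1}` (the exponents are `a : Fin d → ℤ`). -/
abbrev LaurentPoly (d : ℕ) : Type := AddMonoidAlgebra ℂ (Fin d → ℤ)

/-- The term `C z^a = C z_0^{a_0} ⋯ z_{d-1}^{a_{d-1}}`. -/
def term {d : ℕ} (a : Fin d → ℤ) (C : ℂ) : LaurentPoly d := AddMonoidAlgebra.single a C

/-- A monomial is a Laurent polynomial with a single term `C z^a`, where `C ≠ 0`. -/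
def IsMonomial {d : ℕ} (h : LaurentPoly d) : Prop :=
  ∃ (a : Fin d → ℤ) (C : ℂ), C ≠ 0 ∧ h = term a C

/-- A Laurent polynomial is irreducible if it is not the product of two non-monomial Laurent
polynomials. -/
def IsIrred {d : ℕ} (h : LaurentPoly d) : Prop :=
  ¬ ∃ f g : LaurentPoly d, ¬ IsMonomial f ∧ ¬ IsMonomial g ∧ h = f * g

/-- `V` is periodic with respect to the lattice `Γ = q_0 ℤ ⊕ ⋯ ⊕ q_{d-1} ℤ`. -/
def IsPeriodic {d : ℕ} (q : Fin d → ℕ) (V : (Fin d → ℤ) → ℂ) : Prop :=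
  ∀ n a : Fin d → ℤ, V (fun j => n j + (q j : ℤ) * a j) = V n

/-- The fundamental cell `W = {n : 0 ≤ n_j ≤ q_j - 1}`. -/
abbrev Cell {d : ℕ} (q : Fin d → ℕ) : Type := (j : Fin d) → Fin (q j)

/-- A point of the cell as a lattice point. -/
def Cell.toLattice {d : ℕ} {q : Fin d → ℕ} (m : Cell q) : Fin d → ℤ := fun j => ((m j : ℕ) : ℤ)

/-- The average `[V]` of `V` over one periodicity cell. -/
def cellAverage {d : ℕ} (q : Fin d → ℕ) (V : (Fin d → ℤ) → ℂ) : ℂ :=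
  (∑ n : Cell q, V n.toLattice) / ((∏ j, q j : ℕ) : ℂ)

/-- The action of `-Δ + V` on functions on `ℤ^d` with values in a complex vector space; the lattice
points at `ℓ¹`-distance one from `n` are the `n ± e_j`. -/
def schrodinger {d : ℕ} {M : Type*} [AddCommGroup M] [Module ℂ M] (V : (Fin d → ℤ) → ℂ)
    (u : (Fin d → ℤ) → M) (n : Fin d → ℤ) : M :=
  -(∑ j : Fin d, (u (n + Pi.single j 1) + u (n - Pi.single j 1))) + V n • u n

/-- The extension of `u : W → ℂ[z^{±1}]` to `ℤ^d` by the boundary condition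
`u (n + q_j e_j) = z_j u n`, i.e. `u (m + (q_0 a_0, …, q_{d-1} a_{d-1})) = z^a u m` for `m ∈ W`.
(For positive `q_j` exactly one summand is not forced to vanish.) -/
def floquetExt {d : ℕ} {q : Fin d → ℕ} (u : Cell q → LaurentPoly d) (n : Fin d → ℤ) :
    LaurentPoly d :=
  ∑ m : Cell q,
    if ∀ j, (q j : ℤ) ∣ n j - m.toLattice j then
      term (fun j => (n j - m.toLattice j) / (q j : ℤ)) 1 * u m
    else 0

/-- The Floquet matrix `𝒟(z)`, indexed by the cell `W`: the matrix of
`u ↦ ((-Δ + V) (floquetExt u))|_W`. -/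
def floquetMatrix {d : ℕ} (q : Fin d → ℕ) (V : (Fin d → ℤ) → ℂ) :
    Matrix (Cell q) (Cell q) (LaurentPoly d) :=
  Matrix.of fun n m => schrodinger V (floquetExt (Pi.single m 1)) n.toLattice

/-- `𝒫(z, E) = det (𝒟(z) - E I)`, as a Laurent polynomial in `z`. -/
def fermiPoly {d : ℕ} (q : Fin d → ℕ) (V : (Fin d → ℤ) → ℂ) (E : ℂ) : LaurentPoly d :=
  (floquetMatrix q V - E • (1 : Matrix (Cell q) (Cell q) (LaurentPoly d))).det

/-- The substitution `z_j ↦ z_j ^ q_j`. -/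
def powSubst {d : ℕ} (q : Fin d → ℕ) (h : LaurentPoly d) : LaurentPoly d :=
  AddMonoidAlgebra.mapDomain (fun (a : Fin d → ℤ) (j : Fin d) => (q j : ℤ) * a j) h

/-- The root of unity `exp (2 π i n / q)`. -/
def rho (q n : ℕ) : ℂ := Complex.exp (2 * Real.pi * Complex.I * ((n : ℂ) / (q : ℂ)))

/-- `∏_{n_1, n_2} (z_2 / ρ¹_{n_1} + z_1 / ρ²_{n_2})`, where `z_1`, `z_2` are the variables with index
`0`, `1`. -/
def firstProduct (q : Fin 2 → ℕ) : LaurentPoly 2 :=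
  ∏ n₁ ∈ Finset.range (q 0), ∏ n₂ ∈ Finset.range (q 1),
    (term ![0, 1] (rho (q 0) n₁)⁻¹ + term ![1, 0] (rho (q 1) n₂)⁻¹)

/-- `∏_{n_1, n_2} (1 / ρ¹_{n_1} + ρ²_{n_2} z_1 z_2)`. -/
def secondProduct (q : Fin 2 → ℕ) : LaurentPoly 2 :=
  ∏ n₁ ∈ Finset.range (q 0), ∏ n₂ ∈ Finset.range (q 1),
    (term ![0, 0] (rho (q 0) n₁)⁻¹ + term ![1, 1] (rho (q 1) n₂))

end FermiVariety

end

/-! The substitution `z_j ↦ z_j ^ q_j` and a diagonal conjugation turn the Floquet matrix into a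
matrix on `∏ ℤ / q_j` in which each unit step carries `z_j` or its inverse (`powSubst_fermiPoly`).
Hence the Newton polygon of `𝒫` is the diamond with vertices `(±q 1, 0)`, `(0, ±q 0)`, and the
vertex coefficients are signed determinants of translations, free of `V` and `E`
(`fermiPoly_support`, `fermiPoly_coeff_vertex`).

Coprimality makes the four edges primitive. Each edge therefore goes entirely to one of two factors,
and opposite edges go to the same one. If neither factor is a monomial, the diamond is the Minkowski
sum of two primitive segments (`segmentSupports_of_mul`). Both factors are then binomials, their
product has only the four vertex terms, and those coefficients fix the factors up to units
(`fermiPoly_eq_of_segmentSupports`).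

It remains to see that the four-term form forces `E = [V]` (`sum_eq_zero_of_gaugeMatrix_det`). At `z
= (1/s, 2/s)` the gauged determinant times `s ^ Q` is the determinant of a quadratic pencil in `s`.
Its linear coefficient must vanish, and by Jacobi's formula that coefficient is a nonzero multiple
of the trace of `diag (V - E)` times the inverse of `S_0 + 2 S_1`, with `S_j` the unit translations.
This inverse is a combination of translations, so its diagonal is constant and the trace is that
constant times `∑ (V - E)`. The Chinese remainder theorem shows that the constant is a single
nonzero power.

The root-of-unity products collapse to the same binomials (`prod_prod_pow_mul_add`). -/

namespace FermiVariety

open AddMonoidAlgebra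

/-! ### Newton polytopes of products, monomials and primitive binomials. -/

/-- The integral linear functional `p ↦ c * p 0 + d * p 1`. -/
def linFunctional (c d : ℤ) : (Fin 2 → ℤ) →+ ℤ where
  toFun p := c * p 0 + d * p 1
  map_zero' := by simp
  map_add' p r := by simp; ring

lemma linFunctional_apply (c d : ℤ) (p : Fin 2 → ℤ) :
    linFunctional c d p = c * p 0 + d * p 1 := rfl

/-- A bound for a linear functional on the Newton polytope of a product is a bound on the Minkowski
sum of the Newton polytopes of the factors. -/
lemma add_le_of_support_mul_le {d : ℕ} (φ : (Fin d → ℤ) →+ ℤ) {f g : LaurentPoly d} {M : ℤ}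
    (h : ∀ p, (f * g).coeff p ≠ 0 → φ p ≤ M) {a b : Fin d → ℤ}
    (ha : f.coeff a ≠ 0) (hb : g.coeff b ≠ 0) : φ a + φ b ≤ M := by
  classical
  obtain ⟨a₁, ha₁, hamax⟩ := f.coeff.support.exists_max_image φ ⟨a, by simpa using ha⟩
  obtain ⟨b₁, hb₁, hbmax⟩ := g.coeff.support.exists_max_image φ ⟨b, by simpa using hb⟩
  obtain ⟨a₀, ha₀, b₀, hb₀, hu⟩ := UniqueSums.uniqueAdd_of_nonempty
    (A := f.coeff.support.filter fun p => φ p = φ a₁)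
    (B := g.coeff.support.filter fun p => φ p = φ b₁)
    ⟨a₁, by simpa using ha₁⟩ ⟨b₁, by simpa using hb₁⟩
  rw [Finset.mem_filter] at ha₀ hb₀
  have hu' : UniqueAdd f.coeff.support g.coeff.support a₀ b₀ := by
    intro x y hx hy hxy
    have h1 := hamax x hx
    have h2 := hbmax y hy
    have h3 : φ x + φ y = φ a₀ + φ b₀ := by rw [← map_add, ← map_add, hxy]
    rw [ha₀.2, hb₀.2] at h3
    exact hu (Finset.mem_filter.2 ⟨hx, by omega⟩) (Finset.mem_filter.2 ⟨hy, by omega⟩) hxy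
  have h0 : (f * g).coeff (a₀ + b₀) ≠ 0 := by
    rw [coeff_mul_add_of_uniqueAdd hu']
    exact mul_ne_zero (by simpa using ha₀.1) (by simpa using hb₀.1)
  have h1 := h _ h0
  rw [map_add, ha₀.2, hb₀.2] at h1
  have h2 := hamax a (by simpa using ha)
  have h3 := hbmax b (by simpa using hb)
  omega

lemma exists_add_of_coeff_mul_ne_zero {d : ℕ} {f g : LaurentPoly d} {p : Fin d → ℤ}
    (h : (f * g).coeff p ≠ 0) :
    ∃ a b, f.coeff a ≠ 0 ∧ g.coeff b ≠ 0 ∧ a + b = p := by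
  classical
  have := support_coeff_mul_subset f g (by simpa using h)
  obtain ⟨a, ha, b, hb, hab⟩ := Finset.mem_add.1 this
  exact ⟨a, b, by simpa using ha, by simpa using hb, hab⟩

lemma coeff_term {d : ℕ} (a p : Fin d → ℤ) (C : ℂ) :
    (term a C).coeff p = if a = p then C else 0 := by
  classical
  rw [term, coeff_single, Finsupp.single_apply]

lemma term_mul_term {d : ℕ} (a b : Fin d → ℤ) (C D : ℂ) :
    term a C * term b D = term (a + b) (C * D) := by
  rw [term, term, term, single_mul_single]

lemma one_eq_term {d : ℕ} : (1 : LaurentPoly d) = term 0 1 := rfl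

lemma IsMonomial.isUnit {d : ℕ} {f : LaurentPoly d} (h : IsMonomial f) : IsUnit f := by
  obtain ⟨a, C, hC, rfl⟩ := h
  refine IsUnit.of_mul_eq_one (term (-a) C⁻¹) ?_
  rw [term_mul_term, mul_inv_cancel₀ hC, add_neg_cancel, one_eq_term]

lemma isMonomial_of_support {d : ℕ} {f : LaurentPoly d} (a : Fin d → ℤ) (ha : f.coeff a ≠ 0)
    (h : ∀ p, f.coeff p ≠ 0 → p = a) : IsMonomial f := by
  refine ⟨a, f.coeff a, ha, ?_⟩
  ext p
  rw [coeff_term]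
  split_ifs with hp
  · rw [hp]
  · by_contra hne
    exact hp (h p hne).symm

/-- A Laurent polynomial with two prescribed points in its support, and no others. -/
lemma eq_binomial_of_support {d : ℕ} {f : LaurentPoly d} {a b : Fin d → ℤ} (hab : a ≠ b)
    (h : ∀ p, f.coeff p ≠ 0 → p = a ∨ p = b) :
    f = term a (f.coeff a) + term b (f.coeff b) := by
  ext p
  rw [coeff_add, Finsupp.add_apply, coeff_term, coeff_term]
  by_cases h0 : f.coeff p = 0
  · split_ifs with h1 h2 h2 <;> simp_all
  · rcases h p h0 with rfl | rfl
    · simp [hab.symm]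
    · simp [hab]

/-- A linear functional is constant on the support of a factor if it is so on that of the product. -/
lemma eq_of_support_mul_eq {d : ℕ} (φ : (Fin d → ℤ) →+ ℤ) {f g : LaurentPoly d} {M : ℤ}
    (h : ∀ p, (f * g).coeff p ≠ 0 → φ p = M) {a b : Fin d → ℤ}
    (ha : f.coeff a ≠ 0) (hb : g.coeff b ≠ 0) : φ a + φ b = M := by
  have h1 := add_le_of_support_mul_le φ (fun p hp => (h p hp).le) ha hb
  have h2 := add_le_of_support_mul_le (-φ) (M := -M)
    (fun p hp => by simp [h p hp]) ha hb
  simp only [AddMonoidHom.neg_apply] at h2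
  omega

/-- A summand of a one-point Newton polytope is a point: both coordinate functionals are constant on
the support of the factor. -/
lemma isMonomial_of_mul {f g : LaurentPoly 2} (h : IsMonomial (f * g)) : IsMonomial f := by
  obtain ⟨c, C, hC, hfg⟩ := h
  have hcc : (f * g).coeff c ≠ 0 := by rw [hfg, coeff_term]; simpa using hC
  have hsup : ∀ p, (f * g).coeff p ≠ 0 → p = c := by
    intro p hp
    rw [hfg, coeff_term] at hp
    by_contra hne
    exact hp (if_neg (Ne.symm hne))
  obtain ⟨a, b, ha, hb, -⟩ := exists_add_of_coeff_mul_ne_zero hcc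
  refine isMonomial_of_support a ha fun p hp => ?_
  have key : ∀ x y, linFunctional x y p = linFunctional x y a := by
    intro x y
    have h1 := eq_of_support_mul_eq (linFunctional x y) (fun r hr => by rw [hsup r hr]) hp hb
    have h2 := eq_of_support_mul_eq (linFunctional x y) (fun r hr => by rw [hsup r hr]) ha hb
    omega
  have h1 := key 1 0
  have h2 := key 0 1
  simp [linFunctional_apply] at h1 h2
  ext i
  fin_cases i
  · exact h1
  · exact h2

lemma IsIrred.isMonomial_or {d : ℕ} {h f g : LaurentPoly d} (hh : IsIrred h) (he : h = f * g) :
    IsMonomial f ∨ IsMonomial g := by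
  by_contra! hc
  exact hh ⟨f, g, hc.1, hc.2, he⟩

/-- Together with `IsMonomial.isUnit` this identifies units with monomials, so that `Associated`
means equality up to a monomial. -/
lemma isMonomial_of_isUnit {f : LaurentPoly 2} (h : IsUnit f) : IsMonomial f := by
  obtain ⟨g, hg⟩ := h.exists_right_inv
  exact isMonomial_of_mul (g := g) (by rw [hg]; exact ⟨0, 1, one_ne_zero, rfl⟩)

/-- A binomial whose exponents differ by a primitive vector is irreducible. -/
lemma isIrred_binomial {a b : Fin 2 → ℤ} {α β : ℂ} (hα : α ≠ 0) (hβ : β ≠ 0)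
    (hab : IsCoprime (a 0 - b 0) (a 1 - b 1)) : IsIrred (term a α + term b β) := by
  rintro ⟨f, g, hf, hg, he⟩
  have hne : a ≠ b := by
    rintro rfl
    obtain ⟨x, y, hxy⟩ := hab
    simp at hxy
  have hsup : ∀ p, (f * g).coeff p ≠ 0 → p = a ∨ p = b := by
    intro p hp
    rw [← he, coeff_add, Finsupp.add_apply, coeff_term, coeff_term] at hp
    by_contra! hc
    exact hp (by rw [if_neg hc.1.symm, if_neg hc.2.symm, add_zero])
  have ha : (f * g).coeff a ≠ 0 := by
    rw [← he, coeff_add, Finsupp.add_apply, coeff_term, coeff_term, if_pos rfl,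
      if_neg hne.symm, add_zero]
    exact hα
  have hb : (f * g).coeff b ≠ 0 := by
    rw [← he, coeff_add, Finsupp.add_apply, coeff_term, coeff_term, if_pos rfl,
      if_neg hne, zero_add]
    exact hβ
  obtain ⟨a₁, a₂, ha₁, ha₂, haa⟩ := exists_add_of_coeff_mul_ne_zero ha
  obtain ⟨b₁, b₂, hb₁, hb₂, hbb⟩ := exists_add_of_coeff_mul_ne_zero hb
  -- The functional `(-v1, v0)` is constant along the segment, and the Bézout functional `(x, y)`
  -- differs by exactly one at its end points. A height difference of one cannot be shared by two
  -- factors.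
  obtain ⟨x, y, hxy⟩ := hab
  set v0 := a 0 - b 0 with hv0
  set v1 := a 1 - b 1 with hv1
  have hperp : ∀ p r, f.coeff p ≠ 0 → g.coeff r ≠ 0 →
      linFunctional (-v1) v0 p + linFunctional (-v1) v0 r = linFunctional (-v1) v0 a := by
    intro p r hp hr
    refine eq_of_support_mul_eq _ (fun s hs => ?_) hp hr
    rcases hsup s hs with rfl | rfl
    · rfl
    · simp only [linFunctional_apply, hv0, hv1]; ring
  have hle : ∀ p r, f.coeff p ≠ 0 → g.coeff r ≠ 0 →
      linFunctional x y p + linFunctional x y r ≤ linFunctional x y a := by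
    intro p r hp hr
    refine add_le_of_support_mul_le _ (fun s hs => ?_) hp hr
    rcases hsup s hs with rfl | rfl
    · rfl
    · simp only [linFunctional_apply]; rw [hv0, hv1] at hxy; linarith
  have hge : ∀ p r, f.coeff p ≠ 0 → g.coeff r ≠ 0 →
      linFunctional x y b ≤ linFunctional x y p + linFunctional x y r := by
    intro p r hp hr
    have := add_le_of_support_mul_le (-linFunctional x y) (M := -linFunctional x y b)
      (fun s hs => ?_) hp hr
    · simp only [AddMonoidHom.neg_apply] at this; omega
    · simp only [AddMonoidHom.neg_apply, neg_le_neg_iff]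
      rcases hsup s hs with rfl | rfl
      · simp only [linFunctional_apply]; rw [hv0, hv1] at hxy; linarith
      · rfl
  have hdiff : linFunctional x y a = linFunctional x y b + 1 := by
    simp only [linFunctional_apply]; rw [hv0, hv1] at hxy; linarith
  -- two points with the same values of both functionals agree
  have hsep : ∀ p r : Fin 2 → ℤ, linFunctional (-v1) v0 p = linFunctional (-v1) v0 r →
      linFunctional x y p = linFunctional x y r → p = r := by
    intro p r h1 h2
    simp only [linFunctional_apply] at h1 h2
    have e0 : p 0 - r 0 = 0 := by linear_combination v0 * h2 - y * h1 - (p 0 - r 0) * hxy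
    have e1 : p 1 - r 1 = 0 := by linear_combination v1 * h2 + x * h1 - (p 1 - r 1) * hxy
    ext i
    fin_cases i
    · exact sub_eq_zero.1 e0
    · exact sub_eq_zero.1 e1
  have hsa : linFunctional x y a = linFunctional x y a₁ + linFunctional x y a₂ := by
    rw [← haa, map_add]
  have hsb : linFunctional x y b = linFunctional x y b₁ + linFunctional x y b₂ := by
    rw [← hbb, map_add]
  have k1 := hle b₁ a₂ hb₁ ha₂
  have k2 := hle a₁ b₂ ha₁ hb₂
  rcases eq_or_ne (linFunctional x y a₁) (linFunctional x y b₁) with h | h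
  · refine hf (isMonomial_of_support a₁ ha₁ fun p hp => hsep _ _ ?_ ?_)
    · have := hperp p a₂ hp ha₂
      have := hperp a₁ a₂ ha₁ ha₂
      omega
    · have := hle p a₂ hp ha₂
      have := hge p b₂ hp hb₂
      omega
  · refine hg (isMonomial_of_support a₂ ha₂ fun p hp => hsep _ _ ?_ ?_)
    · have := hperp a₁ p ha₁ hp
      have := hperp a₁ a₂ ha₁ ha₂
      omega
    · have := hle a₁ p ha₁ hp
      have := hge b₁ p hb₁ hp
      omega

/-! ### Factorizations over a diamond with primitive edges. -/

lemma exists_eq_mul_of_isCoprime {a b x y : ℤ} (hb : b ≠ 0) (hab : IsCoprime a b)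
    (h : a * x + b * y = 0) : ∃ k : ℤ, x = k * b ∧ y = -(k * a) := by
  have hdvd : b ∣ x := hab.symm.dvd_of_dvd_mul_left ⟨-y, by linarith⟩
  obtain ⟨k, rfl⟩ := hdvd
  refine ⟨k, mul_comm _ _, mul_left_cancel₀ hb ?_⟩
  linear_combination h

/-- If two vertices of the Newton polygon of `f * g` lie on an edge and differ by a primitive
vector, then they split as sums of points of the supports whose differences are integral multiples
of this vector. -/
lemma exists_edge_multiples {f g : LaurentPoly 2} {c d : ℤ} (hd : d ≠ 0) (hcd : IsCoprime c d)
    {M : ℤ} (h : ∀ p r, f.coeff p ≠ 0 → g.coeff r ≠ 0 →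
      linFunctional c d p + linFunctional c d r ≤ M)
    {x₁ x₂ y₁ y₂ : Fin 2 → ℤ} (hx₁ : f.coeff x₁ ≠ 0) (hx₂ : g.coeff x₂ ≠ 0) (hy₁ : f.coeff y₁ ≠ 0)
    (hy₂ : g.coeff y₂ ≠ 0) (hx : linFunctional c d (x₁ + x₂) = M)
    (hy : linFunctional c d (y₁ + y₂) = M) (hxy : (x₁ + x₂) 0 - (y₁ + y₂) 0 = d) :
    ∃ k l : ℤ, k + l = 1 ∧ x₁ 0 - y₁ 0 = k * d ∧ x₁ 1 - y₁ 1 = -(k * c) ∧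
      x₂ 0 - y₂ 0 = l * d ∧ x₂ 1 - y₂ 1 = -(l * c) := by
  -- The two crossed sums are each at most `M` and total `2 * M`, so both are equalities. The
  -- functional thus agrees at `x₁` and `y₁`, and at `x₂` and `y₂`.
  have h1 := h _ _ hx₁ hy₂
  have h2 := h _ _ hy₁ hx₂
  rw [map_add] at hx hy
  simp only [linFunctional_apply] at h1 h2 hx hy
  obtain ⟨k, hk1, hk2⟩ := exists_eq_mul_of_isCoprime (x := x₁ 0 - y₁ 0) (y := x₁ 1 - y₁ 1) hd hcd
    (by linarith)
  obtain ⟨l, hl1, hl2⟩ := exists_eq_mul_of_isCoprime (x := x₂ 0 - y₂ 0) (y := x₂ 1 - y₂ 1) hd hcd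
    (by linarith)
  refine ⟨k, l, mul_right_cancel₀ hd ?_, hk1, hk2, hl1, hl2⟩
  simp only [Pi.add_apply] at hxy
  linarith

/-- The factors `f` and `g` are supported at the end points of two segments that are parallel to the
edges of the diamond `|a x| + |b y| ≤ a b`. -/
def SegmentSupports (a b : ℤ) (f g : LaurentPoly 2) : Prop :=
  ∃ A C : Fin 2 → ℤ, A + C = ![b, 0] ∧
    (∀ p, f.coeff p ≠ 0 → p = A ∨ p = A - ![b, -a]) ∧
    (∀ p, g.coeff p ≠ 0 → p = C ∨ p = C - ![b, a])

/-- Pairing a point of one support with the two known points of the other bounds the same functional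
from both sides. This puts the point on a line with primitive direction, and the remaining
inequalities leave only the two end points. -/
lemma segmentSupports_of_vertices {a b : ℤ} (hb : 0 < b) (hab : IsCoprime a b)
    {f g : LaurentPoly 2}
    (h : ∀ p r, f.coeff p ≠ 0 → g.coeff r ≠ 0 → |a * (p + r) 0| + |b * (p + r) 1| ≤ a * b)
    (ha : 0 < a) {A C : Fin 2 → ℤ} (hAC : A + C = ![b, 0])
    (hA : f.coeff A ≠ 0) (hA' : f.coeff (A - ![b, -a]) ≠ 0)
    (hC : g.coeff C ≠ 0) (hC' : g.coeff (C - ![b, a]) ≠ 0) : SegmentSupports a b f g := by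
  have e0 := congrFun hAC 0
  have e1 := congrFun hAC 1
  simp at e0 e1
  have hle : ∀ {x y M : ℤ}, |x| + |y| ≤ M → x + y ≤ M ∧ x - y ≤ M ∧ -x + y ≤ M ∧ -x - y ≤ M := by
    intro x y M h
    have := le_abs_self x; have := neg_le_abs x; have := le_abs_self y; have := neg_le_abs y
    refine ⟨?_, ?_, ?_, ?_⟩ <;> linarith
  have hk : ∀ k : ℤ, k * b ≤ 0 → -b ≤ k * b → k = 0 ∨ k = -1 := by
    intro k h1 h2
    have : k ≤ 0 := by by_contra! hc; nlinarith
    have : -1 ≤ k := by by_contra! hc; nlinarith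
    omega
  refine ⟨A, C, hAC, fun p hp => ?_, fun p hp => ?_⟩
  · obtain ⟨l1, l2, -, -⟩ := hle (h p C hp hC)
    obtain ⟨-, -, r3, r4⟩ := hle (h p _ hp hC')
    simp only [Pi.add_apply, Pi.sub_apply, Matrix.cons_val_zero, Matrix.cons_val_one] at l1 l2 r3 r4
    obtain ⟨k, hk1, hk2⟩ := exists_eq_mul_of_isCoprime (x := p 0 - A 0) (y := p 1 - A 1) hb.ne' hab
      (by nlinarith)
    have h1 : p 0 - A 0 ≤ 0 := by
      by_contra! hc; nlinarith
    have h2 : -b ≤ p 0 - A 0 := by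
      by_contra! hc; nlinarith
    rcases hk k (by linarith) (by linarith) with rfl | rfl
    · left; ext i; fin_cases i <;> simp <;> linarith
    · right; ext i; fin_cases i <;> simp <;> linarith
  · obtain ⟨l1, l2, -, -⟩ := hle (h A p hA hp)
    obtain ⟨-, -, r3, r4⟩ := hle (h _ p hA' hp)
    simp only [Pi.add_apply, Pi.sub_apply, Matrix.cons_val_zero, Matrix.cons_val_one] at l1 l2 r3 r4
    obtain ⟨k, hk1, hk2⟩ := exists_eq_mul_of_isCoprime (a := -a) (x := p 0 - C 0) (y := p 1 - C 1)
      hb.ne' hab.neg_left (by nlinarith)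
    have h1 : p 0 - C 0 ≤ 0 := by
      by_contra! hc; nlinarith
    have h2 : -b ≤ p 0 - C 0 := by
      by_contra! hc; nlinarith
    rcases hk k (by linarith) (by linarith) with rfl | rfl
    · left; ext i; fin_cases i <;> simp <;> linarith
    · right; ext i; fin_cases i <;> simp <;> linarith

/-- A support contained in a degenerate box is that of a monomial. -/
lemma isMonomial_of_box {f : LaurentPoly 2} {A : Fin 2 → ℤ} (hA : f.coeff A ≠ 0)
    (h : ∀ p, f.coeff p ≠ 0 → p 0 ≤ A 0 ∧ A 0 ≤ p 0 ∧ p 1 ≤ A 1 ∧ A 1 ≤ p 1) : IsMonomial f := by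
  refine isMonomial_of_support A hA fun p hp => ?_
  obtain ⟨h1, h2, h3, h4⟩ := h p hp
  ext i
  fin_cases i
  · exact le_antisymm h1 h2
  · exact le_antisymm h3 h4

/-- Factorizations of a Laurent polynomial whose Newton polygon is the diamond
`|a x| + |b y| ≤ a b`, with `a` and `b` coprime. -/
theorem segmentSupports_of_mul {a b : ℤ} (ha : 0 < a) (hb : 0 < b) (hab : IsCoprime a b)
    {f g : LaurentPoly 2}
    (hsup : ∀ p, (f * g).coeff p ≠ 0 → |a * p 0| + |b * p 1| ≤ a * b)
    (h1 : (f * g).coeff ![b, 0] ≠ 0) (h2 : (f * g).coeff ![0, a] ≠ 0)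
    (h3 : (f * g).coeff ![-b, 0] ≠ 0) (h4 : (f * g).coeff ![0, -a] ≠ 0)
    (hf : ¬ IsMonomial f) (hg : ¬ IsMonomial g) :
    SegmentSupports a b f g ∨ SegmentSupports a b g f := by
  have hle : ∀ {x y M : ℤ}, |x| + |y| ≤ M → x + y ≤ M ∧ x - y ≤ M ∧ -x + y ≤ M ∧ -x - y ≤ M := by
    intro x y M h
    have := le_abs_self x; have := neg_le_abs x; have := le_abs_self y; have := neg_le_abs y
    refine ⟨?_, ?_, ?_, ?_⟩ <;> linarith
  have H1 : ∀ p r, f.coeff p ≠ 0 → g.coeff r ≠ 0 →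
      linFunctional a b p + linFunctional a b r ≤ a * b := fun p r hp hr =>
    add_le_of_support_mul_le _ (fun s hs => by
      have := hle (hsup s hs); simp only [linFunctional_apply]; linarith) hp hr
  have H2 : ∀ p r, f.coeff p ≠ 0 → g.coeff r ≠ 0 →
      linFunctional a (-b) p + linFunctional a (-b) r ≤ a * b := fun p r hp hr =>
    add_le_of_support_mul_le _ (fun s hs => by
      have := hle (hsup s hs); simp only [linFunctional_apply]; linarith) hp hr
  have H3 : ∀ p r, f.coeff p ≠ 0 → g.coeff r ≠ 0 →
      linFunctional (-a) b p + linFunctional (-a) b r ≤ a * b := fun p r hp hr =>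
    add_le_of_support_mul_le _ (fun s hs => by
      have := hle (hsup s hs); simp only [linFunctional_apply]; linarith) hp hr
  have H4 : ∀ p r, f.coeff p ≠ 0 → g.coeff r ≠ 0 →
      linFunctional (-a) (-b) p + linFunctional (-a) (-b) r ≤ a * b := fun p r hp hr =>
    add_le_of_support_mul_le _ (fun s hs => by
      have := hle (hsup s hs); simp only [linFunctional_apply]; linarith) hp hr
  have Habs : ∀ p r, f.coeff p ≠ 0 → g.coeff r ≠ 0 →
      |a * (p + r) 0| + |b * (p + r) 1| ≤ a * b := by
    intro p r hp hr
    have e1 := H1 p r hp hr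
    have e2 := H2 p r hp hr
    have e3 := H3 p r hp hr
    have e4 := H4 p r hp hr
    simp only [linFunctional_apply] at e1 e2 e3 e4
    simp only [Pi.add_apply]
    rcases abs_cases (a * (p 0 + r 0)) with h | h <;>
      rcases abs_cases (b * (p 1 + r 1)) with h' | h' <;> rw [h.1, h'.1] <;> linarith
  have X1 : ∀ p r, f.coeff p ≠ 0 → g.coeff r ≠ 0 → p 0 + r 0 ≤ b := by
    intro p r hp hr
    have e1 := H1 p r hp hr
    have e2 := H2 p r hp hr
    simp only [linFunctional_apply] at e1 e2
    exact le_of_mul_le_mul_left (by linarith) ha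
  have X2 : ∀ p r, f.coeff p ≠ 0 → g.coeff r ≠ 0 → -b ≤ p 0 + r 0 := by
    intro p r hp hr
    have e1 := H3 p r hp hr
    have e2 := H4 p r hp hr
    simp only [linFunctional_apply] at e1 e2
    exact le_of_mul_le_mul_left (by linarith) ha
  have Y1 : ∀ p r, f.coeff p ≠ 0 → g.coeff r ≠ 0 → p 1 + r 1 ≤ a := by
    intro p r hp hr
    have e1 := H1 p r hp hr
    have e2 := H3 p r hp hr
    simp only [linFunctional_apply] at e1 e2
    exact le_of_mul_le_mul_left (by linarith) hb
  have Y2 : ∀ p r, f.coeff p ≠ 0 → g.coeff r ≠ 0 → -a ≤ p 1 + r 1 := by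
    intro p r hp hr
    have e1 := H2 p r hp hr
    have e2 := H4 p r hp hr
    simp only [linFunctional_apply] at e1 e2
    exact le_of_mul_le_mul_left (by linarith) hb
  obtain ⟨A, A', hA, hA', eA⟩ := exists_add_of_coeff_mul_ne_zero h1
  obtain ⟨B, B', hB, hB', eB⟩ := exists_add_of_coeff_mul_ne_zero h2
  obtain ⟨C, C', hC, hC', eC⟩ := exists_add_of_coeff_mul_ne_zero h3
  obtain ⟨D, D', hD, hD', eD⟩ := exists_add_of_coeff_mul_ne_zero h4
  -- On the `i`-th edge, `k_i` and `l_i` are the shares of the edge vector that fall to `f` and `g`.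
  obtain ⟨k₁, l₁, s₁, p₁, p₁', r₁, r₁'⟩ := exists_edge_multiples hb.ne' hab H1 hA hA' hB hB'
    (by simp [eA, linFunctional_apply]) (by simp [eB, linFunctional_apply, mul_comm])
    (by rw [eA, eB]; simp)
  obtain ⟨k₂, l₂, s₂, p₂, p₂', r₂, r₂'⟩ := exists_edge_multiples hb.ne' hab.neg_left H3
    hB hB' hC hC' (by simp [eB, linFunctional_apply, mul_comm]) (by simp [eC, linFunctional_apply])
    (by rw [eB, eC]; simp)
  obtain ⟨k₃, l₃, s₃, p₃, p₃', r₃, r₃'⟩ := exists_edge_multiples (neg_ne_zero.2 hb.ne')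
    hab.neg_neg H4 hC hC' hD hD' (by simp [eC, linFunctional_apply])
    (by simp [eD, linFunctional_apply, mul_comm]) (by rw [eC, eD]; simp)
  obtain ⟨k₄, l₄, s₄, p₄, p₄', r₄, r₄'⟩ := exists_edge_multiples (neg_ne_zero.2 hb.ne')
    hab.neg_right H2 hD hD' hA hA' (by simp [eD, linFunctional_apply, mul_comm])
    (by simp [eA, linFunctional_apply]) (by rw [eD, eA]; simp)
  have A0 := congrFun eA 0
  have A1 := congrFun eA 1
  have B0 := congrFun eB 0
  have B1 := congrFun eB 1
  have C0 := congrFun eC 0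
  have C1 := congrFun eC 1
  have D0 := congrFun eD 0
  have D1 := congrFun eD 1
  simp at A0 A1 B0 B1 C0 C1 D0 D1
  have hnn : ∀ k : ℤ, 0 ≤ k * b → 0 ≤ k := fun k hk => nonneg_of_mul_nonneg_left hk hb
  have hk₁ : 0 ≤ k₁ := hnn _ (by have := X1 B A' hB hA'; linarith)
  have hl₁ : 0 ≤ l₁ := hnn _ (by have := X1 A B' hA hB'; linarith)
  have hk₂ : 0 ≤ k₂ := hnn _ (by have := X2 B C' hB hC'; linarith)
  have hl₂ : 0 ≤ l₂ := hnn _ (by have := X2 C B' hC hB'; linarith)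
  -- The edge vectors of `f` sum to zero around the polygon, so opposite edges have equal shares.
  -- Nonnegative integer shares with sum one are `0` or `1`.
  have hsum0 : k₁ + k₂ = k₃ + k₄ := by
    refine mul_right_cancel₀ hb.ne' ?_
    linarith
  have hsum1 : k₁ - k₂ = k₃ - k₄ := by
    refine mul_right_cancel₀ ha.ne' ?_
    linarith
  obtain rfl : k₃ = k₁ := by omega
  obtain rfl : k₄ = k₂ := by omega
  obtain rfl : l₁ = 1 - k₃ := by omega
  obtain rfl : l₂ = 1 - k₄ := by omega
  obtain rfl : l₃ = 1 - k₃ := by omega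
  obtain rfl : l₄ = 1 - k₄ := by omega
  have c1 : k₃ = 0 ∨ k₃ = 1 := by omega
  have c2 : k₄ = 0 ∨ k₄ = 1 := by omega
  rcases c1 with rfl | rfl <;> rcases c2 with rfl | rfl <;>
    norm_num at p₁ p₁' p₂ p₂' p₃ p₃' p₄ p₄' r₁ r₁' r₂ r₂' r₃ r₃' r₄ r₄'
  · refine absurd (isMonomial_of_box hA fun p hp => ?_) hf
    have := X1 p A' hp hA'
    have := X2 p C' hp hC'
    have := Y1 p B' hp hB'
    have := Y2 p D' hp hD'
    refine ⟨?_, ?_, ?_, ?_⟩ <;> linarith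
  · right
    refine segmentSupports_of_vertices hb hab (fun p r hp hr => ?_) ha (A := A') (C := A)
      (by rw [add_comm, eA]) hA' ?_ hA ?_
    · rw [add_comm p r]; exact Habs r p hr hp
    · convert hB' using 2
      ext i; fin_cases i <;> simp <;> linarith
    · convert hC using 2
      ext i; fin_cases i <;> simp <;> linarith
  · left
    refine segmentSupports_of_vertices hb hab Habs ha (A := A) (C := A')
      eA hA ?_ hA' ?_
    · convert hB using 2
      ext i; fin_cases i <;> simp <;> linarith
    · convert hC' using 2
      ext i; fin_cases i <;> simp <;> linarith
  · refine absurd (isMonomial_of_box hA' fun p hp => ?_) hg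
    have := X1 A p hA hp
    have := X2 C p hC hp
    have := Y1 B p hB hp
    have := Y2 D p hD hp
    refine ⟨?_, ?_, ?_, ?_⟩ <;> linarith

/-! ### Translations of the cell group and the gauge transformation. -/

/-- The matrix of the translation `g ↦ g + v` of a group. -/
def translationMatrix {G : Type*} [AddGroup G] [DecidableEq G] (R : Type*) [Zero R] [One R] (v : G) :
    Matrix G G R :=
  Matrix.of fun g h => if g + v = h then 1 else 0

section Translation

variable {G : Type*} [AddCommGroup G] [DecidableEq G] {R : Type*} [CommRing R]

lemma translationMatrix_apply (v g h : G) :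
    translationMatrix R v g h = if g + v = h then 1 else 0 := rfl

lemma translationMatrix_zero : translationMatrix R (0 : G) = 1 := by
  ext g h
  simp [translationMatrix_apply, Matrix.one_apply]

lemma translationMatrix_mul [Fintype G] (v w : G) :
    translationMatrix R v * translationMatrix R w = translationMatrix R (v + w) := by
  ext g h
  rw [Matrix.mul_apply, Finset.sum_eq_single (g + v)]
  · simp [translationMatrix_apply, add_assoc]
  · intro b _ hb
    rw [translationMatrix_apply, if_neg hb.symm, zero_mul]
  · simp

lemma translationMatrix_pow [Fintype G] (v : G) (k : ℕ) :
    translationMatrix R v ^ k = translationMatrix R (k • v) := by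
  induction k with
  | zero => rw [pow_zero, zero_smul, translationMatrix_zero]
  | succ k ih => rw [pow_succ, ih, translationMatrix_mul, succ_nsmul]

end Translation

/-- The group `∏ ℤ / q_j`. -/
abbrev CellGroup {d : ℕ} (q : Fin d → ℕ) : Type := (j : Fin d) → ZMod (q j)

/-- The class of a lattice point. -/
def latticeClass {d : ℕ} (q : Fin d → ℕ) (n : Fin d → ℤ) : CellGroup q := fun j => (n j : ZMod (q j))

lemma latticeClass_add {d : ℕ} (q : Fin d → ℕ) (n m : Fin d → ℤ) :
    latticeClass q (n + m) = latticeClass q n + latticeClass q m := by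
  ext j; simp [latticeClass]

lemma latticeClass_sub {d : ℕ} (q : Fin d → ℕ) (n m : Fin d → ℤ) :
    latticeClass q (n - m) = latticeClass q n - latticeClass q m := by
  ext j; simp [latticeClass]

lemma latticeClass_single {d : ℕ} (q : Fin d → ℕ) (j : Fin d) :
    latticeClass q (Pi.single j 1) = Pi.single j 1 := by
  ext i
  rcases eq_or_ne i j with rfl | h
  · simp [latticeClass]
  · simp [latticeClass, h]

/-- The points of the cell represent the classes of lattice points. -/
def cellEquiv {d : ℕ} (q : Fin d → ℕ) [∀ j, NeZero (q j)] : Cell q ≃ CellGroup q where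
  toFun m := fun j => ((m j : ℕ) : ZMod (q j))
  invFun g := fun j => ⟨(g j).val, ZMod.val_lt _⟩
  left_inv m := by ext j; simp [ZMod.val_cast_of_lt (m j).isLt]
  right_inv g := by ext j; simp

lemma latticeClass_toLattice {d : ℕ} (q : Fin d → ℕ) [∀ j, NeZero (q j)] (m : Cell q) :
    latticeClass q m.toLattice = cellEquiv q m := by
  ext j
  simp [latticeClass, Cell.toLattice, cellEquiv]

lemma forall_dvd_sub_iff {d : ℕ} (q : Fin d → ℕ) [∀ j, NeZero (q j)] (n : Fin d → ℤ) (m : Cell q) :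
    (∀ j, (q j : ℤ) ∣ n j - m.toLattice j) ↔ latticeClass q n = cellEquiv q m := by
  rw [← latticeClass_toLattice, funext_iff]
  refine forall_congr' fun j => ?_
  rw [latticeClass, latticeClass, eq_comm, ZMod.intCast_eq_intCast_iff_dvd_sub]

/-- The ring homomorphism `z_j ↦ z_j ^ q_j`. -/
noncomputable def powSubstHom {d : ℕ} (q : Fin d → ℕ) : LaurentPoly d →+* LaurentPoly d :=
  AddMonoidAlgebra.mapDomainRingHom ℂ
    ({ toFun := fun a j => (q j : ℤ) * a j
       map_zero' := by ext; simp
       map_add' := fun a b => by ext; simp [mul_add] } : (Fin d → ℤ) →+ (Fin d → ℤ))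

lemma powSubstHom_apply {d : ℕ} (q : Fin d → ℕ) (h : LaurentPoly d) :
    powSubstHom q h = powSubst q h := rfl

lemma powSubst_term {d : ℕ} (q : Fin d → ℕ) (a : Fin d → ℤ) (C : ℂ) :
    powSubst q (term a C) = term (fun j => (q j : ℤ) * a j) C := by
  rw [powSubst, term, mapDomain_single]; rfl

/-- The Floquet matrix after the substitution `z_j ↦ z_j ^ q_j` and conjugation by the diagonal matrix
with entries `z ^ n`: all steps in direction `j` carry the factor `z_j`. -/
noncomputable def gaugeMatrix {d : ℕ} (q : Fin d → ℕ) (w : CellGroup q → ℂ) :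
    Matrix (CellGroup q) (CellGroup q) (LaurentPoly d) :=
  Matrix.of fun g h =>
    -(∑ j, ((if g + Pi.single j 1 = h then term (Pi.single j 1) 1 else 0) +
      (if g - Pi.single j 1 = h then term (-Pi.single j 1) 1 else 0))) +
      if g = h then term 0 (w g) else 0

/-- A function on the cell as a function on classes of lattice points. -/
def cellPotential {d : ℕ} (q : Fin d → ℕ) [∀ j, NeZero (q j)] (V : (Fin d → ℤ) → ℂ) (E : ℂ)
    (g : CellGroup q) : ℂ :=
  V ((cellEquiv q).symm g).toLattice - E

/-- After the substitution the Floquet multiplier is `z ^ (n - m)`, a quotient of a factor at `n` by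
one at `m`. Conjugation can therefore remove it. -/
lemma powSubst_floquetExt {d : ℕ} (q : Fin d → ℕ) [∀ j, NeZero (q j)] (m : Cell q)
    (n : Fin d → ℤ) :
    powSubst q (floquetExt (Pi.single m 1) n) =
      if latticeClass q n = cellEquiv q m then term (n - m.toLattice) 1 else 0 := by
  rw [floquetExt, Finset.sum_eq_single m, Pi.single_eq_same, mul_one]
  · by_cases h : ∀ j, (q j : ℤ) ∣ n j - m.toLattice j
    · rw [if_pos h, if_pos ((forall_dvd_sub_iff q n m).1 h), powSubst_term]
      congr 1
      ext j
      exact Int.mul_ediv_cancel' (h j)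
    · rw [if_neg h, if_neg (mt (forall_dvd_sub_iff q n m).2 h), ← powSubstHom_apply, map_zero]
  · intro b _ hb
    rw [Pi.single_eq_of_ne hb, mul_zero, ite_self]
  · simp

lemma smul_eq_term_mul {d : ℕ} (c : ℂ) (h : LaurentPoly d) : c • h = term 0 c * h := by
  ext p; simp [term]

lemma powSubst_floquetMatrix_apply {d : ℕ} (q : Fin d → ℕ) [∀ j, NeZero (q j)]
    (V : (Fin d → ℤ) → ℂ) (E : ℂ) (n m : Cell q) :
    powSubst q ((floquetMatrix q V - E • (1 : Matrix (Cell q) (Cell q) (LaurentPoly d))) n m) =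
      term n.toLattice 1 * gaugeMatrix q (cellPotential q V E) (cellEquiv q n) (cellEquiv q m) *
        term (-m.toLattice) 1 := by
  have hterm : ∀ a, term n.toLattice 1 * term a 1 * term (-m.toLattice) 1 =
      term (n.toLattice + a - m.toLattice) 1 := by
    intro a
    rw [term_mul_term, term_mul_term, sub_eq_add_neg, mul_one, mul_one]
  have h1 : ∀ (c : Prop) [Decidable c] (x : LaurentPoly d),
      term n.toLattice 1 * (if c then x else 0) * term (-m.toLattice) 1 =
        if c then term n.toLattice 1 * x * term (-m.toLattice) 1 else 0 := by
    intro c _ x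
    split_ifs <;> simp
  simp only [Matrix.sub_apply, floquetMatrix, Matrix.of_apply, schrodinger, Matrix.smul_apply,
    gaugeMatrix, smul_eq_term_mul, ← powSubstHom_apply, map_sub, map_add, map_neg, map_sum, map_mul]
  simp only [powSubstHom_apply, powSubst_floquetExt, latticeClass_add, latticeClass_sub,
    latticeClass_single, latticeClass_toLattice, mul_add, add_mul, mul_neg, neg_mul,
    Finset.mul_sum, Finset.sum_mul, h1, hterm, powSubst_term]
  rw [add_sub_assoc]
  congr 1
  simp only [(cellEquiv q).injective.eq_iff, Matrix.one_apply]
  by_cases h : n = m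
  · subst h
    simp only [if_true, sub_self, term_mul_term, cellPotential, Equiv.symm_apply_apply]
    rw [← powSubstHom_apply, map_one, mul_one, one_eq_term, term_mul_term]
    simp [term]
    rfl
  · simp [h, ← powSubstHom_apply]

/-- The two diagonal matrices have entries `z ^ n` and `z ^ (-n)`, so their determinants cancel. -/
theorem powSubst_fermiPoly {d : ℕ} (q : Fin d → ℕ) [∀ j, NeZero (q j)] (V : (Fin d → ℤ) → ℂ)
    (E : ℂ) : powSubst q (fermiPoly q V E) = (gaugeMatrix q (cellPotential q V E)).det := by
  have h : (powSubstHom q).mapMatrix (floquetMatrix q V - E • (1 : Matrix (Cell q) (Cell q) _)) =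
      Matrix.diagonal (fun n : Cell q => term n.toLattice 1) *
        (gaugeMatrix q (cellPotential q V E)).submatrix (cellEquiv q) (cellEquiv q) *
          Matrix.diagonal (fun n : Cell q => term (-n.toLattice) 1) := by
    ext1 n m
    rw [Matrix.mul_diagonal, Matrix.diagonal_mul, Matrix.submatrix_apply,
      ← powSubst_floquetMatrix_apply]
    rfl
  rw [fermiPoly, ← powSubstHom_apply, RingHom.map_det, h, Matrix.det_mul, Matrix.det_mul,
    Matrix.det_submatrix_equiv_self, Matrix.det_diagonal, Matrix.det_diagonal, mul_right_comm,
    ← Finset.prod_mul_distrib]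
  simp [term_mul_term, ← one_eq_term]

/-! ### Extremal coefficients of products and determinants. -/

lemma coeff_one {d : ℕ} (p : Fin d → ℤ) :
    (1 : LaurentPoly d).coeff p = if (0 : Fin d → ℤ) = p then 1 else 0 := by
  rw [one_eq_term, coeff_term]

lemma coeff_ite_term {d : ℕ} (c : Prop) [Decidable c] (a p : Fin d → ℤ) (C : ℂ) :
    (if c then term a C else 0).coeff p = if a = p ∧ c then C else 0 := by
  by_cases h : c <;> simp [h, coeff_term]

lemma le_of_coeff_prod_ne_zero {d : ℕ} {ι : Type*} (φ : (Fin d → ℤ) →+ ℤ) (s : Finset ι)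
    (h : ι → LaurentPoly d) (hh : ∀ i ∈ s, ∀ p, (h i).coeff p ≠ 0 → φ p ≤ 1)
    {p : Fin d → ℤ} (hp : (∏ i ∈ s, h i).coeff p ≠ 0) : φ p ≤ s.card := by
  classical
  induction s using Finset.induction_on generalizing p with
  | empty =>
    rw [Finset.prod_empty, coeff_one] at hp
    have : p = 0 := by by_contra hc; exact hp (if_neg (Ne.symm hc))
    simp [this]
  | insert i s hi ih =>
    rw [Finset.prod_insert hi] at hp
    obtain ⟨a, b, ha, hb, rfl⟩ := exists_add_of_coeff_mul_ne_zero hp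
    have h1 := hh i (Finset.mem_insert_self i s) a ha
    have h2 := ih (fun j hj => hh j (Finset.mem_insert_of_mem hj)) hb
    rw [map_add, Finset.card_insert_of_notMem hi]
    push_cast
    omega

/-- The coefficient of a product at an exposed vertex of the sum of the Newton polytopes. -/
lemma coeff_prod_vertex {d : ℕ} {ι : Type*} (φ : (Fin d → ℤ) →+ ℤ) (v : Fin d → ℤ) (hv : φ v = 1)
    (s : Finset ι) (h : ι → LaurentPoly d)
    (hh : ∀ i ∈ s, ∀ p, (h i).coeff p ≠ 0 → φ p ≤ 1 ∧ (φ p = 1 → p = v)) :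
    (∏ i ∈ s, h i).coeff (s.card • v) = ∏ i ∈ s, (h i).coeff v := by
  classical
  induction s using Finset.induction_on with
  | empty => simp
  | insert i s hi ih =>
    have hs : ∀ j ∈ s, ∀ p, (h j).coeff p ≠ 0 → φ p ≤ 1 ∧ (φ p = 1 → p = v) :=
      fun j hj => hh j (Finset.mem_insert_of_mem hj)
    rw [Finset.prod_insert hi, Finset.prod_insert hi, Finset.card_insert_of_notMem hi, ← ih hs,
      succ_nsmul, add_comm]
    -- The sum has the maximal value of `φ`, so each summand is maximal on its factor. Exposedness
    -- then forces the first summand to be `v`.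
    refine coeff_mul_add_of_uniqueAdd fun a b ha hb hab => ?_
    have h1 := hh i (Finset.mem_insert_self i s) a (by simpa using ha)
    have h2 := le_of_coeff_prod_ne_zero φ s h (fun j hj p hp => (hs j hj p hp).1)
      (p := b) (by simpa using hb)
    have h3 := congrArg φ hab
    rw [map_add, map_add, map_nsmul, hv, nsmul_one] at h3
    have ha' := h1.2 (by omega)
    subst ha'
    exact ⟨rfl, add_left_cancel hab⟩

variable {d : ℕ} {n : Type*} [Fintype n] [DecidableEq n]

lemma coeff_det (M : Matrix n n (LaurentPoly d)) (p : Fin d → ℤ) :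
    M.det.coeff p = ∑ σ : Equiv.Perm n, (Equiv.Perm.sign σ : ℤ) * (∏ i, M (σ i) i).coeff p := by
  rw [Matrix.det_apply, coeff_sum, Finsupp.finsetSum_apply]
  refine Finset.sum_congr rfl fun σ _ => ?_
  rcases Int.units_eq_one_or (Equiv.Perm.sign σ) with h | h <;> simp [h]

lemma le_of_coeff_det_ne_zero (φ : (Fin d → ℤ) →+ ℤ) (M : Matrix n n (LaurentPoly d))
    (hM : ∀ i j p, (M i j).coeff p ≠ 0 → φ p ≤ 1) {p : Fin d → ℤ} (hp : M.det.coeff p ≠ 0) :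
    φ p ≤ Fintype.card n := by
  rw [coeff_det] at hp
  obtain ⟨σ, -, hσ⟩ := Finset.exists_ne_zero_of_sum_ne_zero hp
  exact le_of_coeff_prod_ne_zero φ Finset.univ _ (fun i _ => hM _ _) (right_ne_zero_of_mul hσ)

/-- Only products of extremal entry terms reach the vertex, which reduces its coefficient to a
scalar determinant. -/
lemma coeff_det_vertex (φ : (Fin d → ℤ) →+ ℤ) (v : Fin d → ℤ) (hv : φ v = 1)
    (M : Matrix n n (LaurentPoly d))
    (hM : ∀ i j p, (M i j).coeff p ≠ 0 → φ p ≤ 1 ∧ (φ p = 1 → p = v)) :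
    M.det.coeff (Fintype.card n • v) = (Matrix.of fun i j => (M i j).coeff v).det := by
  rw [coeff_det, Matrix.det_apply]
  refine Finset.sum_congr rfl fun σ _ => ?_
  rw [← Finset.card_univ, coeff_prod_vertex φ v hv Finset.univ _ (fun i _ => hM _ _)]
  rcases Int.units_eq_one_or (Equiv.Perm.sign σ) with h | h <;> simp [h]

/-! ### The Newton polygon of `𝒫` and its vertex coefficients. -/

lemma gaugeMatrix_coeff (q : Fin 2 → ℕ) (w : CellGroup q → ℂ) (g h : CellGroup q)
    (p : Fin 2 → ℤ) :
    (gaugeMatrix q w g h).coeff p =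
      -(((if Pi.single 0 1 = p ∧ g + Pi.single 0 1 = h then 1 else 0) +
        (if -Pi.single 0 1 = p ∧ g - Pi.single 0 1 = h then 1 else 0)) +
        ((if Pi.single 1 1 = p ∧ g + Pi.single 1 1 = h then 1 else 0) +
        (if -Pi.single 1 1 = p ∧ g - Pi.single 1 1 = h then 1 else 0))) +
      (if 0 = p ∧ g = h then w g else 0) := by
  simp only [gaugeMatrix, Matrix.of_apply, Fin.sum_univ_two, coeff_add, coeff_neg,
    Finsupp.add_apply, Finsupp.neg_apply, coeff_ite_term]

lemma mem_of_gaugeMatrix_coeff_ne_zero (q : Fin 2 → ℕ) (w : CellGroup q → ℂ) (g h : CellGroup q)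
    (p : Fin 2 → ℤ) (hp : (gaugeMatrix q w g h).coeff p ≠ 0) :
    p = Pi.single 0 1 ∨ p = -Pi.single 0 1 ∨ p = Pi.single 1 1 ∨ p = -Pi.single 1 1 ∨ p = 0 := by
  by_contra! hc
  obtain ⟨h1, h2, h3, h4, h5⟩ := hc
  refine hp ?_
  rw [gaugeMatrix_coeff, if_neg (fun h => h1 h.1.symm), if_neg (fun h => h2 h.1.symm),
    if_neg (fun h => h3 h.1.symm), if_neg (fun h => h4 h.1.symm), if_neg (fun h => h5 h.1.symm)]
  simp

lemma card_cellGroup (q : Fin 2 → ℕ) [∀ j, NeZero (q j)] :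
    Fintype.card (CellGroup q) = q 0 * q 1 := by
  rw [Fintype.card_pi, Fin.prod_univ_two, ZMod.card, ZMod.card]

lemma abs_add_abs_le_of_gaugeMatrix_det (q : Fin 2 → ℕ) [∀ j, NeZero (q j)] (w : CellGroup q → ℂ)
    {p : Fin 2 → ℤ} (hp : (gaugeMatrix q w).det.coeff p ≠ 0) :
    |p 0| + |p 1| ≤ (q 0 : ℤ) * q 1 := by
  have key : ∀ c d : ℤ, |c| ≤ 1 → |d| ≤ 1 → c * p 0 + d * p 1 ≤ (q 0 : ℤ) * q 1 := by
    intro c d hc hd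
    rw [abs_le] at hc hd
    have := le_of_coeff_det_ne_zero (linFunctional c d) (gaugeMatrix q w) (fun g h r hr => ?_) hp
    · rw [card_cellGroup] at this
      push_cast at this
      exact this
    · rcases mem_of_gaugeMatrix_coeff_ne_zero q w g h r hr with rfl | rfl | rfl | rfl | rfl <;>
        simp [linFunctional_apply] <;> linarith
  have h1 := key 1 1 (by simp) (by simp)
  have h2 := key 1 (-1) (by simp) (by simp)
  have h3 := key (-1) 1 (by simp) (by simp)
  have h4 := key (-1) (-1) (by simp) (by simp)
  rcases abs_cases (p 0) with h | h <;> rcases abs_cases (p 1) with h' | h' <;>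
    rw [h.1, h'.1] <;> linarith

/-- The functional `p ↦ ε * p j` equals one at a single step only. The diagonal terms lie at height
zero, so the potential drops out. -/
lemma gaugeMatrix_det_coeff_vertex (q : Fin 2 → ℕ) [∀ j, NeZero (q j)] (w : CellGroup q → ℂ)
    (j : Fin 2) (ε : ℤ) (hε : ε = 1 ∨ ε = -1) :
    (gaugeMatrix q w).det.coeff ((q 0 * q 1) • Pi.single j ε) =
      (-translationMatrix ℂ (Pi.single j (ε : ZMod (q j)) : CellGroup q)).det := by
  have hε2 : ε * ε = 1 := by rcases hε with rfl | rfl <;> rfl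
  rw [← card_cellGroup, coeff_det_vertex
    (linFunctional (Pi.single (M := fun _ : Fin 2 => ℤ) j ε 0)
      (Pi.single (M := fun _ : Fin 2 => ℤ) j ε 1)) _ ?_ _ fun g h p hp => ?_]
  · congr 1
    ext g h
    have hs : ∀ i : Fin 2, ∀ δ : ℤ, δ = 1 ∨ δ = -1 →
        (Pi.single (M := fun _ : Fin 2 => ℤ) i δ = Pi.single j ε ↔ i = j ∧ δ = ε) := by
      intro i δ hδ
      constructor
      · intro he
        have h0 := congrFun he 0
        have h1 := congrFun he 1
        fin_cases i <;> fin_cases j <;> simp at h0 h1 ⊢ <;> omega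
      · rintro ⟨rfl, rfl⟩; rfl
    rw [Matrix.of_apply, gaugeMatrix_coeff]
    simp only [← Pi.single_neg, hs _ 1 (by simp), hs _ (-1) (by simp), Matrix.neg_apply,
      translationMatrix_apply]
    have h0 : (0 : Fin 2 → ℤ) ≠ Pi.single j ε := by
      intro he
      have := congrFun he j
      rcases hε with rfl | rfl <;> simp at this
    simp only [h0, false_and, if_false]
    rcases hε with rfl | rfl <;> fin_cases j <;> simp [sub_eq_add_neg, Pi.single_neg]
  · fin_cases j <;> simp [linFunctional_apply, hε2]
  · rcases mem_of_gaugeMatrix_coeff_ne_zero q w g h p hp with rfl | rfl | rfl | rfl | rfl <;>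
      rcases hε with rfl | rfl <;> fin_cases j <;> simp [linFunctional_apply, Pi.single_neg]

/-- The sign of the translation by one in the direction `j`. -/
lemma sign_addRight_one (n : ℕ) [NeZero n] :
    Equiv.Perm.sign (Equiv.addRight (1 : ZMod n)) = (-1) ^ (n - 1) := by
  obtain ⟨k, rfl⟩ := Nat.exists_eq_succ_of_ne_zero (NeZero.ne n)
  have : (Equiv.addRight (1 : ZMod (k + 1)) : Equiv.Perm (ZMod (k + 1))) = finRotate (k + 1) := by
    refine Equiv.ext fun x => ?_
    exact (finRotate_apply (n := k + 1) x).symm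
  exact (congrArg _ this).trans (sign_finRotate _)

lemma translationMatrix_eq_permMatrix {G : Type*} [AddCommGroup G] [DecidableEq G] (R : Type*)
    [CommRing R] (v : G) : translationMatrix R v = (Equiv.addRight v).permMatrix R := by
  ext g h
  simp [translationMatrix_apply, Equiv.Perm.permMatrix, PEquiv.toMatrix_apply, eq_comm]

/-- The translation acts as a cycle of length `q j` on each of `q (1 - j)` fibres; `1 - j` is the
other index. -/
lemma sign_addRight_single (q : Fin 2 → ℕ) [∀ j, NeZero (q j)] (j : Fin 2) :
    Equiv.Perm.sign (Equiv.addRight (Pi.single j 1 : CellGroup q)) =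
      ((-1) ^ (q j - 1)) ^ q (1 - j) := by
  fin_cases j
  · have := Equiv.Perm.sign_prodCongrLeft (fun _ : ZMod (q 1) => Equiv.addRight (1 : ZMod (q 0)))
    rw [Finset.prod_const, Finset.card_univ, ZMod.card, sign_addRight_one] at this
    refine Eq.trans ?_ this
    refine Equiv.Perm.sign_eq_sign_of_equiv _ _ (piFinTwoEquiv fun j => ZMod (q j)) fun x => ?_
    ext <;> simp
  · have := Equiv.Perm.sign_prodCongrRight (fun _ : ZMod (q 0) => Equiv.addRight (1 : ZMod (q 1)))
    rw [Finset.prod_const, Finset.card_univ, ZMod.card, sign_addRight_one] at this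
    refine Eq.trans ?_ this
    refine Equiv.Perm.sign_eq_sign_of_equiv _ _ (piFinTwoEquiv fun j => ZMod (q j)) fun x => ?_
    ext <;> simp

/-- The sign of the permutation of the cell induced by a unit translation in direction `j`. -/
def cellSign (q : Fin 2 → ℕ) (j : Fin 2) : ℂ := ((-1) ^ (q j - 1)) ^ q (1 - j)

lemma cellSign_mul_self (q : Fin 2 → ℕ) (j : Fin 2) : cellSign q j * cellSign q j = 1 := by
  rw [cellSign, ← mul_pow, ← mul_pow]
  simp

lemma cellSign_ne_zero (q : Fin 2 → ℕ) (j : Fin 2) : cellSign q j ≠ 0 :=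
  left_ne_zero_of_mul_eq_one (cellSign_mul_self q j)

lemma translationMatrix_det (q : Fin 2 → ℕ) [∀ j, NeZero (q j)] (j : Fin 2) :
    (translationMatrix ℂ (Pi.single j 1 : CellGroup q)).det = cellSign q j := by
  rw [translationMatrix_eq_permMatrix, Matrix.det_permutation, sign_addRight_single, cellSign]
  push_cast
  rfl

lemma translationMatrix_det_neg (q : Fin 2 → ℕ) [∀ j, NeZero (q j)] (j : Fin 2) :
    (translationMatrix ℂ (Pi.single j (-1) : CellGroup q)).det = cellSign q j := by
  have h : (translationMatrix ℂ (Pi.single j 1 : CellGroup q)).det *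
      (translationMatrix ℂ (Pi.single j (-1) : CellGroup q)).det = 1 := by
    rw [← Matrix.det_mul, translationMatrix_mul, ← Pi.single_add, add_neg_cancel, Pi.single_zero,
      translationMatrix_zero, Matrix.det_one]
  rw [translationMatrix_det] at h
  exact mul_left_cancel₀ (cellSign_ne_zero q j) (h.trans (cellSign_mul_self q j).symm)

lemma gaugeMatrix_det_coeff_vertex_eq (q : Fin 2 → ℕ) [∀ j, NeZero (q j)] (w : CellGroup q → ℂ)
    (j : Fin 2) (ε : ℤ) (hε : ε = 1 ∨ ε = -1) :
    (gaugeMatrix q w).det.coeff ((q 0 * q 1) • Pi.single j ε) =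
      (-1) ^ (q 0 * q 1) * cellSign q j := by
  rw [gaugeMatrix_det_coeff_vertex q w j ε hε, Matrix.det_neg, card_cellGroup]
  rcases hε with rfl | rfl
  · rw [Int.cast_one, translationMatrix_det]
  · rw [Int.cast_neg, Int.cast_one, translationMatrix_det_neg]

lemma mul_left_injective_of_pos {d : ℕ} (q : Fin d → ℕ) [∀ j, NeZero (q j)] :
    Function.Injective fun (a : Fin d → ℤ) (j : Fin d) => (q j : ℤ) * a j := by
  intro a b h
  ext j
  exact mul_left_cancel₀ (by simpa using NeZero.ne (q j)) (congrFun h j)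

lemma coeff_powSubst {d : ℕ} (q : Fin d → ℕ) [∀ j, NeZero (q j)] (h : LaurentPoly d)
    (p : Fin d → ℤ) : (powSubst q h).coeff (fun j => (q j : ℤ) * p j) = h.coeff p :=
  Finsupp.mapDomain_apply (mul_left_injective_of_pos q) _ _

lemma fermiPoly_support (q : Fin 2 → ℕ) [∀ j, NeZero (q j)] (V : (Fin 2 → ℤ) → ℂ) (E : ℂ)
    {p : Fin 2 → ℤ} (hp : (fermiPoly q V E).coeff p ≠ 0) :
    |(q 0 : ℤ) * p 0| + |(q 1 : ℤ) * p 1| ≤ (q 0 : ℤ) * q 1 := by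
  rw [← coeff_powSubst q, powSubst_fermiPoly] at hp
  exact abs_add_abs_le_of_gaugeMatrix_det q _ hp

/-- The indices cross: the exponent `q 1` of the variable `0` becomes `q 0 * q 1` after the
substitution. -/
lemma fermiPoly_coeff_vertex (q : Fin 2 → ℕ) [∀ j, NeZero (q j)] (V : (Fin 2 → ℤ) → ℂ) (E : ℂ)
    (ε : ℤ) (hε : ε = 1 ∨ ε = -1) :
    (fermiPoly q V E).coeff ![ε * q 1, 0] = (-1) ^ (q 0 * q 1) * cellSign q 0 ∧
    (fermiPoly q V E).coeff ![0, ε * q 0] = (-1) ^ (q 0 * q 1) * cellSign q 1 := by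
  rw [← gaugeMatrix_det_coeff_vertex_eq q (cellPotential q V E) 0 ε hε,
    ← gaugeMatrix_det_coeff_vertex_eq q (cellPotential q V E) 1 ε hε, ← powSubst_fermiPoly]
  constructor
  · rw [← coeff_powSubst q (fermiPoly q V E)]
    congr 1
    funext i
    fin_cases i <;> simp <;> ring
  · rw [← coeff_powSubst q (fermiPoly q V E)]
    congr 1
    funext i
    fin_cases i <;> simp <;> ring

/-! ### The linear coefficient of a pencil and the mean of the potential. -/

/-- The linear coefficient of the determinant of a quadratic matrix pencil with invertible
constant term. -/
lemma coeff_one_det_pencil {n : Type*} [Fintype n] [DecidableEq n] {R : Type*} [CommRing R]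
    {A B : Matrix n n R} (N₀ N₁ : Matrix n n R) (hAB : A * B = 1) :
    (A.map Polynomial.C + (Polynomial.X : Polynomial R) • (N₀.map Polynomial.C +
      (Polynomial.X : Polynomial R) • N₁.map Polynomial.C)).det.coeff 1 * B.det =
      (N₀ * B).trace := by
  have h : ∀ M : Matrix n n R, (M.map Polynomial.C).trace = Polynomial.C M.trace := fun M => by
    simp [Matrix.trace]
  -- Multiplication by `B` normalizes the constant term to the identity, and the linear coefficient
  -- of `det (1 + X • M)` is read off from the trace.
  rw [← Polynomial.coeff_mul_C, show Polynomial.C B.det = (B.map Polynomial.C).det from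
    RingHom.map_det _ _, ← Matrix.det_mul, Matrix.add_mul, ← Matrix.map_mul, hAB,
    Matrix.map_one _ Polynomial.C_0 Polynomial.C_1, Matrix.smul_mul, Matrix.det_one_add_smul,
    Matrix.add_mul, Matrix.smul_mul, ← Matrix.map_mul, ← Matrix.map_mul, Matrix.trace_add,
    Matrix.trace_smul, h]
  simp [Polynomial.coeff_one, Polynomial.coeff_mul_X_pow']

section Inverse

variable {G : Type*} [AddCommGroup G] [DecidableEq G] [Fintype G]

/-- The inverse of `S_u + 2 S_v`, up to a constant factor, as a geometric series. -/
lemma mul_sum_translationMatrix (u v : G) :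
    (translationMatrix ℂ u + (2 : ℂ) • translationMatrix ℂ v) *
      (∑ k ∈ Finset.range (Fintype.card G), (-2 : ℂ) ^ k • translationMatrix ℂ (k • (v - u) - u)) =
      (1 - (-2 : ℂ) ^ Fintype.card G) • (1 : Matrix G G ℂ) := by
  -- With `S_u` factored out, the finite geometric sum suffices because the order of the group
  -- annihilates `v - u`.
  have h1 : (translationMatrix ℂ u + (2 : ℂ) • translationMatrix ℂ v) =
      translationMatrix ℂ u * (1 - (-2 : ℂ) • translationMatrix ℂ (v - u)) := by
    rw [mul_sub, mul_one, mul_smul_comm, translationMatrix_mul, add_sub_cancel, neg_smul,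
      sub_neg_eq_add]
  have h2 : ∀ k ∈ Finset.range (Fintype.card G),
      (-2 : ℂ) ^ k • translationMatrix ℂ (k • (v - u) - u) =
      ((-2 : ℂ) • translationMatrix ℂ (v - u)) ^ k * translationMatrix ℂ (-u) := by
    intro k _
    rw [smul_pow, translationMatrix_pow, smul_mul_assoc, translationMatrix_mul, sub_eq_add_neg]
  rw [Finset.sum_congr rfl h2, ← Finset.sum_mul, h1, mul_assoc, ← mul_assoc (1 - _),
    mul_neg_geom_sum, smul_pow, translationMatrix_pow, card_nsmul_eq_zero, translationMatrix_zero,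
    ← one_smul ℂ (1 : Matrix G G ℂ), smul_smul, ← sub_smul, mul_one, smul_mul_assoc, one_mul,
    mul_smul_comm, translationMatrix_mul, add_neg_cancel, translationMatrix_zero, one_smul]

/-- This is why the two variables are evaluated with ratio `2`: with ratio `1` the corresponding
constant `1 - (-1) ^ N` vanishes for even `N`. -/
lemma neg_two_pow_ne_one {N : ℕ} (hN : 0 < N) : (1 : ℂ) - (-2) ^ N ≠ 0 := by
  intro h
  have h1 : ‖((-2 : ℂ)) ^ N‖ = 1 := by rw [← sub_eq_zero.1 h, norm_one]
  rw [norm_pow, norm_neg, Complex.norm_ofNat] at h1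
  exact (one_lt_pow₀ (one_lt_two (α := ℝ)) hN.ne').ne' h1

/-- A translation matrix has constant diagonal, nonzero only for the trivial translation, so the
trace depends on `w` only through its sum. -/
lemma trace_diagonal_mul_sum_translationMatrix (w : G → ℂ) (N : ℕ) (t : ℕ → G) :
    (Matrix.diagonal w * ∑ k ∈ Finset.range N, (-2 : ℂ) ^ k • translationMatrix ℂ (t k)).trace =
      (∑ g, w g) * ∑ k ∈ Finset.range N, if t k = 0 then (-2 : ℂ) ^ k else 0 := by
  rw [Matrix.trace, Finset.sum_mul]
  refine Finset.sum_congr rfl fun g _ => ?_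
  rw [Matrix.diag_apply, Matrix.diagonal_mul, Matrix.sum_apply]
  simp [translationMatrix_apply]

end Inverse

/-- The condition on `k` is `k ≡ -1` modulo `q 0` and `k ≡ 0` modulo `q 1`. By coprimality exactly
one `k` in the range satisfies it, so nothing can cancel. -/
lemma sum_neg_two_pow_ne_zero (q : Fin 2 → ℕ) [∀ j, NeZero (q j)]
    (hcop : Nat.Coprime (q 0) (q 1)) :
    (∑ k ∈ Finset.range (q 0 * q 1),
      if k • (Pi.single 1 1 - Pi.single 0 1 : CellGroup q) - Pi.single 0 1 = 0 then (-2 : ℂ) ^ k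
      else 0) ≠ 0 := by
  have hiff : ∀ k : ℕ, k • (Pi.single 1 1 - Pi.single 0 1 : CellGroup q) - Pi.single 0 1 = 0 ↔
      ((k : ZMod (q 0)) = -1 ∧ (k : ZMod (q 1)) = 0) := by
    intro k
    rw [funext_iff, Fin.forall_fin_two]
    simp only [Pi.sub_apply, Pi.smul_apply, Pi.single_eq_same, Pi.zero_apply, ne_eq, zero_ne_one,
      not_false_eq_true, Pi.single_eq_of_ne, one_ne_zero, sub_zero, zero_sub]
    simp only [nsmul_eq_mul, mul_one, mul_neg]
    refine and_congr_left fun _ => ?_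
    constructor <;> intro h <;> linear_combination -h
  let k₀ := Nat.chineseRemainder hcop (q 0 - 1) 0
  have hk₀ : ((k₀ : ℕ) : ZMod (q 0)) = -1 ∧ ((k₀ : ℕ) : ZMod (q 1)) = 0 := by
    refine ⟨?_, ?_⟩
    · rw [(ZMod.natCast_eq_natCast_iff _ _ _).2 k₀.2.1,
        Nat.cast_sub (Nat.one_le_iff_ne_zero.2 (NeZero.ne _))]
      simp
    · rw [(ZMod.natCast_eq_natCast_iff _ _ _).2 k₀.2.2, Nat.cast_zero]
  have hlt : (k₀ : ℕ) < q 0 * q 1 := Nat.chineseRemainder_lt_mul hcop _ _ (NeZero.ne _) (NeZero.ne _)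
  rw [Finset.sum_eq_single (k₀ : ℕ)]
  · rw [if_pos ((hiff _).2 hk₀)]
    exact pow_ne_zero _ (by norm_num)
  · intro k hk hne
    refine if_neg fun h => hne ?_
    have h' := (hiff k).1 h
    have e0 := (ZMod.natCast_eq_natCast_iff _ _ _).1 (h'.1.trans hk₀.1.symm)
    have e1 := (ZMod.natCast_eq_natCast_iff _ _ _).1 (h'.2.trans hk₀.2.symm)
    exact ((Nat.modEq_and_modEq_iff_modEq_mul hcop).1 ⟨e0, e1⟩).eq_of_lt_of_lt
      (Finset.mem_range.1 hk) hlt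
  · intro h
    exact absurd (Finset.mem_range.2 hlt) h

/-- The evaluation of Laurent polynomials at `(x, y)`. -/
noncomputable def evalHom {x y : ℂ} (hx : x ≠ 0) (hy : y ≠ 0) : LaurentPoly 2 →+* ℂ :=
  AddMonoidAlgebra.liftNCRingHom (RingHom.id ℂ)
    { toFun := fun p => x ^ (p.toAdd 0) * y ^ (p.toAdd 1)
      map_one' := by simp
      map_mul' := fun p r => by
        simp only [toAdd_mul, Pi.add_apply, zpow_add₀ hx, zpow_add₀ hy]
        ring } (fun _ _ => Commute.all _ _)

lemma evalHom_term {x y : ℂ} (hx : x ≠ 0) (hy : y ≠ 0) (p : Fin 2 → ℤ) (C : ℂ) :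
    evalHom hx hy (term p C) = C * (x ^ p 0 * y ^ p 1) := by
  rw [term, evalHom, AddMonoidAlgebra.liftNCRingHom_single]
  rfl

/-- The quadratic pencil that the matrix `gaugeMatrix` becomes at `(1 / s, 2 / s)`. -/
noncomputable def pencil (q : Fin 2 → ℕ) (w : CellGroup q → ℂ) :
    Matrix (CellGroup q) (CellGroup q) (Polynomial ℂ) :=
  (-(translationMatrix ℂ (Pi.single 0 1 : CellGroup q) +
      (2 : ℂ) • translationMatrix ℂ (Pi.single 1 1 : CellGroup q))).map Polynomial.C +
    (Polynomial.X : Polynomial ℂ) • ((Matrix.diagonal w).map Polynomial.C +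
      (Polynomial.X : Polynomial ℂ) •
        (-(translationMatrix ℂ (-Pi.single 0 1 : CellGroup q) +
          (1 / 2 : ℂ) • translationMatrix ℂ (-Pi.single 1 1 : CellGroup q))).map Polynomial.C)

/-- One factor `s` per row clears the denominators: forward steps become constant, the potential
linear and backward steps quadratic in `s`. -/
lemma pencil_det_eval (q : Fin 2 → ℕ) [∀ j, NeZero (q j)] (w : CellGroup q → ℂ) {s : ℂ}
    (hs : s ≠ 0) : (pencil q w).det.eval s = s ^ (q 0 * q 1) *
      evalHom (inv_ne_zero hs) (mul_ne_zero two_ne_zero (inv_ne_zero hs))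
        (gaugeMatrix q w).det := by
  rw [RingHom.map_det, ← card_cellGroup q, ← Matrix.det_smul, ← Polynomial.coe_evalRingHom,
    RingHom.map_det]
  congr 1
  ext g h
  simp only [pencil, RingHom.mapMatrix_apply, Matrix.map_apply, Matrix.add_apply, Matrix.smul_apply,
    Matrix.neg_apply, translationMatrix_apply, smul_eq_mul, Polynomial.coe_evalRingHom,
    Polynomial.eval_add, Polynomial.eval_mul, Polynomial.eval_X, Polynomial.eval_C, gaugeMatrix,
    Matrix.of_apply, Fin.sum_univ_two, map_add, map_neg, ← sub_eq_add_neg, Matrix.diagonal_apply]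
  have hite : ∀ (c : Prop) [Decidable c] (p : Fin 2 → ℤ) (C : ℂ),
      evalHom (inv_ne_zero hs) (mul_ne_zero two_ne_zero (inv_ne_zero hs))
        (if c then term p C else 0) =
      (if c then 1 else 0) * C * ((s⁻¹) ^ p 0 * (2 * s⁻¹) ^ p 1) := by
    intro c _ p C
    split_ifs
    · rw [evalHom_term, one_mul]
    · simp
  simp only [hite]
  have e : (if g = h then w g else 0) = (if g = h then 1 else 0) * w g := by split_ifs <;> simp
  rw [e]
  generalize (if g + Pi.single 0 1 = h then (1 : ℂ) else 0) = a₁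
  generalize (if g + Pi.single 1 1 = h then (1 : ℂ) else 0) = a₂
  generalize (if g - Pi.single 0 1 = h then (1 : ℂ) else 0) = a₃
  generalize (if g - Pi.single 1 1 = h then (1 : ℂ) else 0) = a₄
  generalize (if g = h then (1 : ℂ) else 0) = a₅
  simp
  field_simp
  ring

/-- If only the vertices of the Newton polygon contribute to `𝒫`, then the potential has mean zero. -/
theorem sum_eq_zero_of_gaugeMatrix_det (q : Fin 2 → ℕ) [∀ j, NeZero (q j)]
    (hcop : Nat.Coprime (q 0) (q 1)) (w : CellGroup q → ℂ) {α β : ℂ}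
    (h : (gaugeMatrix q w).det =
      term ![(q 0 * q 1 : ℕ), 0] α + term ![-(q 0 * q 1 : ℕ), 0] α +
      (term ![0, (q 0 * q 1 : ℕ)] β + term ![0, -(q 0 * q 1 : ℕ)] β)) :
    ∑ g, w g = 0 := by
  set Q := q 0 * q 1 with hQ
  have hQpos : 0 < Q := Nat.mul_pos (NeZero.pos _) (NeZero.pos _)
  have hpoly : (pencil q w).det = Polynomial.C (α + β * 2 ^ Q) +
      Polynomial.C (α + β * (2 ^ Q)⁻¹) * Polynomial.X ^ (2 * Q) := by
    refine Polynomial.eq_of_infinite_eval_eq _ _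
      (Set.Infinite.mono ?_ (Set.finite_singleton (0 : ℂ)).infinite_compl)
    intro s hs
    have hs : s ≠ 0 := hs
    rw [Set.mem_ofPred_eq, pencil_det_eval q w hs, h]
    simp only [map_add, evalHom_term]
    simp [mul_pow, ← hQ]
    field_simp
    ring
  -- The only exponents present are `0` and `2 * Q`, and the latter is never `1`.
  have hcoeff : (pencil q w).det.coeff 1 = 0 := by
    rw [hpoly]
    simp only [Polynomial.coeff_add, Polynomial.coeff_C, Polynomial.coeff_C_mul,
      Polynomial.coeff_X_pow]
    rw [if_neg one_ne_zero, if_neg (by omega), mul_zero, add_zero]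
  have hinv := mul_sum_translationMatrix (Pi.single 0 1 : CellGroup q) (Pi.single 1 1)
  have hc : (1 : ℂ) - (-2) ^ Fintype.card (CellGroup q) ≠ 0 :=
    neg_two_pow_ne_one (by rw [card_cellGroup]; exact hQpos)
  set T := ∑ k ∈ Finset.range (Fintype.card (CellGroup q)), (-2 : ℂ) ^ k •
    translationMatrix ℂ (k • (Pi.single 1 1 - Pi.single 0 1 : CellGroup q) - Pi.single 0 1) with hT
  have hAB : (-(translationMatrix ℂ (Pi.single 0 1 : CellGroup q) +
      (2 : ℂ) • translationMatrix ℂ (Pi.single 1 1 : CellGroup q))) *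
      ((-(1 - (-2) ^ Fintype.card (CellGroup q))⁻¹ : ℂ) • T) = 1 := by
    rw [mul_smul_comm, neg_mul, hinv, smul_neg, neg_smul, neg_neg, smul_smul,
      inv_mul_cancel₀ hc, one_smul]
  have htrace := coeff_one_det_pencil (Matrix.diagonal w)
    (-(translationMatrix ℂ (-Pi.single 0 1 : CellGroup q) +
          (1 / 2 : ℂ) • translationMatrix ℂ (-Pi.single 1 1 : CellGroup q))) hAB
  rw [← pencil, hcoeff, zero_mul, mul_smul_comm, Matrix.trace_smul, hT,
    trace_diagonal_mul_sum_translationMatrix, card_cellGroup] at htrace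
  rw [card_cellGroup] at hc
  rcases smul_eq_zero.1 htrace.symm with h | h
  · exact absurd h (neg_ne_zero.2 (inv_ne_zero hc))
  · exact (mul_eq_zero.1 h).resolve_right (sum_neg_two_pow_ne_zero q hcop)

lemma eq_cellAverage_of_sum_eq_zero (q : Fin 2 → ℕ) [∀ j, NeZero (q j)] (V : (Fin 2 → ℤ) → ℂ)
    (E : ℂ) (h : ∑ g, cellPotential q V E g = 0) : E = cellAverage q V := by
  have hQ : ((q 0 : ℂ) * q 1) ≠ 0 :=
    mul_ne_zero (by simpa using NeZero.ne (q 0)) (by simpa using NeZero.ne (q 1))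
  rw [← (cellEquiv q).sum_comp] at h
  simp only [cellPotential, Equiv.symm_apply_apply, Finset.sum_sub_distrib, Finset.sum_const,
    Finset.card_univ, Fintype.card_pi, Fin.prod_univ_two, Fintype.card_fin, nsmul_eq_mul,
    Nat.cast_mul] at h
  rw [cellAverage, Fin.prod_univ_two, Nat.cast_mul, eq_div_iff hQ]
  linear_combination -h

/-! ### Products over roots of unity and the explicit binomials. -/

section RootsOfUnity

variable {R : Type*} [CommRing R] [IsDomain R]

lemma prod_range_sub_pow_mul {n : ℕ} {ζ : R} (hn : 0 < n) (hζ : IsPrimitiveRoot ζ n) (x y : R) :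
    ∏ i ∈ Finset.range n, (x - ζ ^ i * y) = x ^ n - y ^ n := by
  rw [hζ.pow_sub_pow_eq_prod_sub_mul x y hn]
  have : NeZero n := ⟨hn.ne'⟩
  refine Finset.prod_nbij (ζ ^ ·) (fun i _ => ?_) (fun i hi j hj hij => ?_) (fun ξ hξ => ?_)
    (fun _ _ => rfl)
  · rw [Polynomial.mem_nthRootsFinset hn, ← pow_mul, mul_comm, pow_mul, hζ.pow_eq_one, one_pow]
  · exact hζ.pow_inj (Finset.mem_range.1 hi) (Finset.mem_range.1 hj) hij
  · obtain ⟨i, hi, rfl⟩ := hζ.eq_pow_of_pow_eq_one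
      ((Polynomial.mem_nthRootsFinset hn _).1 (Finset.mem_coe.1 hξ))
    exact ⟨i, by simpa using hi, rfl⟩

/-- The product of all linear forms `ω ^ i y + η ^ j x` for roots of unity of coprime orders. -/
lemma prod_prod_pow_mul_add {a b : ℕ} (ha : 0 < a) (hb : 0 < b) (hab : a.Coprime b) {ω η : R}
    (hω : IsPrimitiveRoot ω a) (hη : IsPrimitiveRoot η b) (x y : R) :
    ∏ i ∈ Finset.range a, ∏ j ∈ Finset.range b, (ω ^ i * y + η ^ j * x) =
      (-1) ^ (a + 1) * y ^ (a * b) + (-1) ^ (a + a * b) * x ^ (a * b) := by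
  -- The inner product collapses over the powers of `η`. It leaves powers of `ω ^ b`, which is again
  -- primitive of order `a` by coprimality, so the outer product collapses too.
  have h1 : ∀ i, ∏ j ∈ Finset.range b, (ω ^ i * y + η ^ j * x) =
      -1 * ((-x) ^ b - (ω ^ b) ^ i * y ^ b) := by
    intro i
    rw [show -1 * ((-x) ^ b - (ω ^ b) ^ i * y ^ b) = (ω ^ i * y) ^ b - (-x) ^ b by ring,
      ← prod_range_sub_pow_mul hb hη]
    refine Finset.prod_congr rfl fun j _ => ?_
    ring
  rw [Finset.prod_congr rfl fun i _ => h1 i, Finset.prod_mul_distrib, Finset.prod_const,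
    Finset.card_range, prod_range_sub_pow_mul ha (hω.pow_of_coprime b hab.symm), ← pow_mul,
    ← pow_mul, neg_pow x]
  ring

end RootsOfUnity

lemma term_pow {d : ℕ} (p : Fin d → ℤ) (C : ℂ) (n : ℕ) :
    term p C ^ n = term (n • p) (C ^ n) := by
  rw [term, term, single_pow]

lemma neg_one_pow_mul_term {d : ℕ} (p : Fin d → ℤ) (C : ℂ) (n : ℕ) :
    (-1) ^ n * term p C = term p ((-1) ^ n * C) := by
  rcases neg_one_pow_eq_or (LaurentPoly d) n with h | h <;>
    rcases neg_one_pow_eq_or ℂ n with h' | h' <;> rw [h, h']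
  · simp
  · have h1 := congrArg (fun f : LaurentPoly d => f.coeff 0) h
    rcases Nat.even_or_odd n with hn | hn
    · rw [hn.neg_one_pow] at h'; norm_num at h'
    · rw [hn.neg_one_pow] at h1; norm_num [coeff_one] at h1
  · have h1 := congrArg (fun f : LaurentPoly d => f.coeff 0) h
    rcases Nat.even_or_odd n with hn | hn
    · rw [hn.neg_one_pow] at h1; norm_num [coeff_one] at h1
    · rw [hn.neg_one_pow] at h'; norm_num at h'
  · simp [term]

lemma rho_eq_pow (n i : ℕ) : rho n i = rho n 1 ^ i := by
  rw [rho, rho, ← Complex.exp_nat_mul]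
  congr 1
  push_cast
  ring

lemma isPrimitiveRoot_rho {n : ℕ} (hn : 0 < n) : IsPrimitiveRoot (rho n 1) n := by
  rw [rho]
  exact Complex.isPrimitiveRoot_exp_of_coprime 1 n hn.ne' (Nat.coprime_one_left n)

lemma isPrimitiveRoot_term {d n : ℕ} {ζ : ℂ} (h : IsPrimitiveRoot ζ n) :
    IsPrimitiveRoot (term 0 ζ : LaurentPoly d) n := by
  refine h.map_of_injective (f := (singleZeroRingHom : ℂ →+* LaurentPoly d)) fun x y hxy => ?_
  exact single_right_injective hxy

/-- This matches the translation sign with the sign from the root-of-unity product. If `q 0` is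
even, coprimality makes `q 1` odd. -/
lemma cellSign_zero (q : Fin 2 → ℕ) (hq : ∀ j, 0 < q j) (hcop : Nat.Coprime (q 0) (q 1)) :
    cellSign q 0 = (-1) ^ (q 0 + 1) := by
  have h0 := hq 0
  rw [cellSign, ← pow_mul]
  show (-1 : ℂ) ^ ((q 0 - 1) * q 1) = _
  rcases Nat.even_or_odd (q 0) with h | h
  · have h1 : Odd (q 1) := by
      by_contra hc
      rw [Nat.not_odd_iff_even] at hc
      exact absurd (Nat.dvd_gcd h.two_dvd hc.two_dvd) (by rw [hcop]; decide)
    rw [h.add_one.neg_one_pow, ((Nat.Even.sub_odd h0 h odd_one).mul h1).neg_one_pow]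
  · rw [h.add_one.neg_one_pow, (Even.mul_right (h.tsub_odd odd_one) _).neg_one_pow]

lemma cellSign_one (q : Fin 2 → ℕ) (hq : ∀ j, 0 < q j) :
    cellSign q 1 = (-1) ^ (q 0 + q 0 * q 1) := by
  rw [cellSign, ← pow_mul]
  show (-1 : ℂ) ^ ((q 1 - 1) * q 0) = _
  obtain ⟨k, hk⟩ := Nat.exists_eq_add_of_lt (hq 1)
  rw [hk, show q 0 + q 0 * (0 + k + 1) = (0 + k + 1 - 1) * q 0 + 2 * q 0 by
    rw [Nat.add_sub_cancel]; ring, pow_add _ _ (2 * q 0), pow_mul _ 2, neg_one_sq, one_pow, mul_one]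

/-- The first explicit factor. -/
noncomputable def firstFactor (q : Fin 2 → ℕ) : LaurentPoly 2 :=
  term ![0, q 0] (cellSign q 0) + term ![q 1, 0] (cellSign q 1)

/-- The second explicit factor. -/
noncomputable def secondFactor (q : Fin 2 → ℕ) : LaurentPoly 2 :=
  term 0 (cellSign q 0) + term ![q 1, q 0] (cellSign q 1)

lemma powSubst_add {d : ℕ} (q : Fin d → ℕ) (f g : LaurentPoly d) :
    powSubst q (f + g) = powSubst q f + powSubst q g := map_add (powSubstHom q) f g

lemma powSubst_mul {d : ℕ} (q : Fin d → ℕ) (f g : LaurentPoly d) :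
    powSubst q (f * g) = powSubst q f * powSubst q g := map_mul (powSubstHom q) f g

lemma powSubst_firstFactor (q : Fin 2 → ℕ) (hq : ∀ j, 0 < q j)
    (hcop : Nat.Coprime (q 0) (q 1)) : powSubst q (firstFactor q) = firstProduct q := by
  have h : ∀ i j, (term ![0, 1] (rho (q 0) i)⁻¹ + term ![1, 0] (rho (q 1) j)⁻¹ : LaurentPoly 2) =
      term 0 (rho (q 0) 1)⁻¹ ^ i * term ![0, 1] 1 + term 0 (rho (q 1) 1)⁻¹ ^ j * term ![1, 0] 1 := by
    intro i j
    rw [term_pow, term_pow, term_mul_term, term_mul_term, rho_eq_pow _ i, rho_eq_pow _ j]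
    simp
  simp only [firstProduct, h]
  rw [prod_prod_pow_mul_add (hq 0) (hq 1) hcop
    (isPrimitiveRoot_term (isPrimitiveRoot_rho (hq 0)).inv)
    (isPrimitiveRoot_term (isPrimitiveRoot_rho (hq 1)).inv), term_pow, term_pow,
    neg_one_pow_mul_term, neg_one_pow_mul_term, one_pow, mul_one, mul_one, ← cellSign_one q hq,
    ← cellSign_zero q hq hcop, firstFactor, powSubst_add, powSubst_term, powSubst_term]
  congr 2 <;> funext i <;> fin_cases i <;> simp <;> ring

lemma powSubst_secondFactor (q : Fin 2 → ℕ) (hq : ∀ j, 0 < q j)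
    (hcop : Nat.Coprime (q 0) (q 1)) : powSubst q (secondFactor q) = secondProduct q := by
  have h : ∀ i j, (term ![0, 0] (rho (q 0) i)⁻¹ + term ![1, 1] (rho (q 1) j) : LaurentPoly 2) =
      term 0 (rho (q 0) 1)⁻¹ ^ i * term ![0, 0] 1 + term 0 (rho (q 1) 1) ^ j * term ![1, 1] 1 := by
    intro i j
    rw [term_pow, term_pow, term_mul_term, term_mul_term, rho_eq_pow _ i, rho_eq_pow _ j]
    simp
  simp only [secondProduct, h]
  rw [prod_prod_pow_mul_add (hq 0) (hq 1) hcop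
    (isPrimitiveRoot_term (isPrimitiveRoot_rho (hq 0)).inv)
    (isPrimitiveRoot_term (isPrimitiveRoot_rho (hq 1))), term_pow, term_pow,
    neg_one_pow_mul_term, neg_one_pow_mul_term, one_pow, mul_one, mul_one, ← cellSign_one q hq,
    ← cellSign_zero q hq hcop, secondFactor, powSubst_add, powSubst_term, powSubst_term]
  congr 2 <;> funext i <;> fin_cases i <;> simp <;> ring

lemma vec2_ne {a b c d : ℤ} (h : a ≠ c ∨ b ≠ d) : (![a, b] : Fin 2 → ℤ) ≠ ![c, d] := by
  intro he
  have h0 := congrFun he 0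
  have h1 := congrFun he 1
  simp at h0 h1
  exact h.elim (fun h => h h0) fun h => h h1

/-! ### Identification of binomial factors from vertex coefficients. -/

/-- The coefficients at the vertices of a product of two binomials with segments as supports. -/
lemma coeff_mul_of_segments {a b : ℤ} (ha : 0 < a) (hb : 0 < b) {f g : LaurentPoly 2}
    {A C : Fin 2 → ℤ} (hAC : A + C = ![b, 0])
    (hf : f = term A (f.coeff A) + term (A - ![b, -a]) (f.coeff (A - ![b, -a])))
    (hg : g = term C (g.coeff C) + term (C - ![b, a]) (g.coeff (C - ![b, a]))) :
    f * g = term ![b, 0] (f.coeff A * g.coeff C) +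
      term ![0, -a] (f.coeff A * g.coeff (C - ![b, a])) +
      (term ![0, a] (f.coeff (A - ![b, -a]) * g.coeff C) +
      term ![-b, 0] (f.coeff (A - ![b, -a]) * g.coeff (C - ![b, a]))) ∧
    (f * g).coeff ![b, 0] = f.coeff A * g.coeff C ∧
    (f * g).coeff ![0, -a] = f.coeff A * g.coeff (C - ![b, a]) ∧
    (f * g).coeff ![0, a] = f.coeff (A - ![b, -a]) * g.coeff C ∧
    (f * g).coeff ![-b, 0] = f.coeff (A - ![b, -a]) * g.coeff (C - ![b, a]) := by
  have h1 : A + (C - ![b, a]) = ![0, -a] := by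
    rw [← add_sub_assoc, hAC]; simp
  have h2 : A - ![b, -a] + C = ![0, a] := by
    rw [sub_add_eq_add_sub, hAC]; simp
  have h3 : A - ![b, -a] + (C - ![b, a]) = ![-b, 0] := by
    rw [← add_sub_assoc, h2]; ext i; fin_cases i <;> simp
  have key : f * g = term ![b, 0] (f.coeff A * g.coeff C) +
      term ![0, -a] (f.coeff A * g.coeff (C - ![b, a])) +
      (term ![0, a] (f.coeff (A - ![b, -a]) * g.coeff C) +
      term ![-b, 0] (f.coeff (A - ![b, -a]) * g.coeff (C - ![b, a]))) := by
    conv_lhs => rw [hf, hg]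
    rw [add_mul, mul_add, mul_add, term_mul_term, term_mul_term, term_mul_term, term_mul_term, hAC,
      h1, h2, h3]
  refine ⟨key, ?_, ?_, ?_, ?_⟩
  · rw [key]
    simp only [coeff_add, Finsupp.add_apply, coeff_term]
    rw [if_pos trivial, if_neg (vec2_ne (by omega)), if_neg (vec2_ne (by omega)),
      if_neg (vec2_ne (by omega))]
    ring
  · rw [key]
    simp only [coeff_add, Finsupp.add_apply, coeff_term]
    rw [if_pos trivial, if_neg (vec2_ne (by omega)), if_neg (vec2_ne (by omega)),
      if_neg (vec2_ne (by omega))]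
    ring
  · rw [key]
    simp only [coeff_add, Finsupp.add_apply, coeff_term]
    rw [if_pos trivial, if_neg (vec2_ne (by omega)), if_neg (vec2_ne (by omega)),
      if_neg (vec2_ne (by omega))]
    ring
  · rw [key]
    simp only [coeff_add, Finsupp.add_apply, coeff_term]
    rw [if_pos trivial, if_neg (vec2_ne (by omega)), if_neg (vec2_ne (by omega)),
      if_neg (vec2_ne (by omega))]
    ring

/-- A binomial is determined up to a unit by its exponent difference and its ratio of
coefficients. -/
lemma associated_binomial {A B A' B' : Fin 2 → ℤ} (hAB : A - B = A' - B') {α β ε δ γ τ : ℂ}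
    (hα : α ≠ 0) (hγ : γ ≠ 0) (hδ : δ * δ = 1) (h1 : α * γ = τ * δ)
    (h2 : β * γ = τ * ε) : Associated (term A α + term B β) (term B' ε + term A' δ) := by
  have hδ0 : δ ≠ 0 := left_ne_zero_of_mul_eq_one hδ
  -- The unit shifts `A'` to `A` and scales by `α / δ`, where `δ` is its own inverse.
  have hu : IsMonomial (term (A - A') (α * δ)) := ⟨_, _, mul_ne_zero hα hδ0, rfl⟩
  obtain ⟨u, hu⟩ := hu.isUnit
  refine Associated.symm ⟨u, ?_⟩
  have hβ : ε * (α * δ) = β := by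
    refine mul_right_cancel₀ hγ ?_
    linear_combination ε * δ * h1 - h2 + τ * ε * hδ
  have e1 : B' + (A - A') = B := by
    rw [← sub_sub_cancel A B, hAB]; abel
  have e2 : A' + (A - A') = A := by abel
  rw [hu, add_mul, term_mul_term, term_mul_term, e1, e2, hβ, mul_left_comm, hδ, mul_one, add_comm]

section Factors

variable (q : Fin 2 → ℕ) (hq : ∀ j, 0 < q j) (hcop : Nat.Coprime (q 0) (q 1))

include hq in
lemma firstFactor_not_isMonomial : ¬ IsMonomial (firstFactor q) := by
  have h0 := hq 0
  have h1 := hq 1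
  rintro ⟨p, C, hC, h⟩
  have e1 : (firstFactor q).coeff ![0, (q 0 : ℤ)] ≠ 0 := by
    rw [firstFactor, coeff_add, Finsupp.add_apply, coeff_term, coeff_term, if_pos rfl,
      if_neg (vec2_ne (by omega)), add_zero]
    exact cellSign_ne_zero q 0
  have e2 : (firstFactor q).coeff ![(q 1 : ℤ), 0] ≠ 0 := by
    rw [firstFactor, coeff_add, Finsupp.add_apply, coeff_term, coeff_term, if_pos rfl,
      if_neg (vec2_ne (by omega)), zero_add]
    exact cellSign_ne_zero q 1
  rw [h, coeff_term] at e1 e2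
  have h3 : p = ![0, (q 0 : ℤ)] := by by_contra hc; exact e1 (if_neg hc)
  have h4 : p = ![(q 1 : ℤ), 0] := by by_contra hc; exact e2 (if_neg hc)
  exact vec2_ne (by omega) (h3.symm.trans h4)

include hq in
lemma secondFactor_coeff_ne_zero : (secondFactor q).coeff 0 ≠ 0 ∧
    (secondFactor q).coeff ![(q 1 : ℤ), (q 0 : ℤ)] ≠ 0 := by
  have h0 := hq 0
  have hne : (![(q 1 : ℤ), (q 0 : ℤ)] : Fin 2 → ℤ) ≠ 0 := by
    intro h; have := congrFun h 1; simp at this; omega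
  constructor
  · rw [secondFactor, coeff_add, Finsupp.add_apply, coeff_term, coeff_term, if_pos rfl,
      if_neg hne, add_zero]
    exact cellSign_ne_zero q 0
  · rw [secondFactor, coeff_add, Finsupp.add_apply, coeff_term, coeff_term, if_pos rfl,
      if_neg hne.symm, zero_add]
    exact cellSign_ne_zero q 1

include hq in
lemma secondFactor_not_isMonomial : ¬ IsMonomial (secondFactor q) := by
  have h0 := hq 0
  rintro ⟨p, C, hC, h⟩
  obtain ⟨e1, e2⟩ := secondFactor_coeff_ne_zero q hq
  rw [h, coeff_term] at e1 e2
  have h3 : p = 0 := by by_contra hc; exact e1 (if_neg hc)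
  have h4 : p = ![(q 1 : ℤ), (q 0 : ℤ)] := by by_contra hc; exact e2 (if_neg hc)
  have := congrFun (h3.symm.trans h4) 1
  simp at this
  omega

include hcop in
lemma firstFactor_isIrred : IsIrred (firstFactor q) := by
  refine isIrred_binomial (cellSign_ne_zero q 0) (cellSign_ne_zero q 1) ?_
  have := Nat.isCoprime_iff_coprime.2 hcop
  simpa using this.symm.neg_left

include hcop in
lemma secondFactor_isIrred : IsIrred (secondFactor q) := by
  refine isIrred_binomial (cellSign_ne_zero q 0) (cellSign_ne_zero q 1) ?_
  have := Nat.isCoprime_iff_coprime.2 hcop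
  simpa using this.symm.neg_neg

include hq in
-- The functional `(q 0, q 1)` is constant on the support of the first factor, hence on that of any
-- associate. On the second it takes the values `0` and `2 * q 0 * q 1`.
lemma not_associated_factors : ¬ Associated (firstFactor q) (secondFactor q) := by
  have h0 := hq 0
  have h1 := hq 1
  rintro ⟨u, hu⟩
  obtain ⟨e, μ, hμ, he⟩ := isMonomial_of_isUnit u.isUnit
  have key : ∀ p, (secondFactor q).coeff p ≠ 0 →
      linFunctional (q 0) (q 1) p = q 0 * q 1 + linFunctional (q 0) (q 1) e := by
    intro p hp
    rw [← hu] at hp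
    obtain ⟨r, s, hr, hs, rfl⟩ := exists_add_of_coeff_mul_ne_zero hp
    rw [he, coeff_term] at hs
    have hs : e = s := by by_contra hc; exact hs (if_neg hc)
    rw [map_add, hs]
    congr 1
    rw [firstFactor, coeff_add, Finsupp.add_apply, coeff_term, coeff_term] at hr
    by_cases c1 : ![0, (q 0 : ℤ)] = r
    · rw [← c1, linFunctional_apply]; simp [mul_comm]
    · by_cases c2 : ![(q 1 : ℤ), 0] = r
      · rw [← c2, linFunctional_apply]; simp
      · exact absurd (by rw [if_neg c1, if_neg c2, add_zero]) hr
  obtain ⟨e1, e2⟩ := secondFactor_coeff_ne_zero q hq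
  have k1 := key _ e1
  have k2 := key _ e2
  rw [← k1, map_zero, linFunctional_apply] at k2
  simp at k2
  have : 0 < (q 0 : ℤ) * q 1 := by positivity
  linarith [mul_comm (q 0 : ℤ) (q 1)]

end Factors

/-! ### Reducible Fermi polynomials, their factors and multiplicities. -/

section Main

variable (q : Fin 2 → ℕ) [∀ j, NeZero (q j)] (hcop : Nat.Coprime (q 0) (q 1))
  (V : (Fin 2 → ℤ) → ℂ) (E : ℂ)

include hcop in
lemma fermiPoly_segmentSupports {f g : LaurentPoly 2} (hfg : fermiPoly q V E = f * g)
    (hf : ¬ IsMonomial f) (hg : ¬ IsMonomial g) :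
    SegmentSupports (q 0) (q 1) f g ∨ SegmentSupports (q 0) (q 1) g f := by
  have hne : ∀ j, (-1 : ℂ) ^ (q 0 * q 1) * cellSign q j ≠ 0 := fun j =>
    mul_ne_zero (pow_ne_zero _ (by norm_num)) (cellSign_ne_zero q j)
  obtain ⟨h1, h2⟩ := fermiPoly_coeff_vertex q V E 1 (Or.inl rfl)
  obtain ⟨h3, h4⟩ := fermiPoly_coeff_vertex q V E (-1) (Or.inr rfl)
  rw [one_mul] at h1 h2
  rw [neg_one_mul] at h3 h4
  refine segmentSupports_of_mul (by simpa using NeZero.pos (q 0)) (by simpa using NeZero.pos (q 1))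
    (Nat.isCoprime_iff_coprime.2 hcop) (fun p hp => ?_) ?_ ?_ ?_ ?_ hf hg
  · rw [← hfg] at hp
    exact fermiPoly_support q V E hp
  · rw [← hfg, h1]; exact hne 0
  · rw [← hfg, h2]; exact hne 1
  · rw [← hfg, h3]; exact hne 0
  · rw [← hfg, h4]; exact hne 1

/-- If `𝒫` is a product of two binomials, then these are the explicit factors up to units, and `𝒫` is
determined by its coefficients at the vertices. -/
lemma fermiPoly_eq_of_segmentSupports {f g : LaurentPoly 2} (hfg : fermiPoly q V E = f * g)
    (h : SegmentSupports (q 0) (q 1) f g) :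
    Associated f (firstFactor q) ∧ Associated g (secondFactor q) ∧
    fermiPoly q V E = term ![(q 1 : ℤ), 0] ((-1) ^ (q 0 * q 1) * cellSign q 0) +
      term ![-(q 1 : ℤ), 0] ((-1) ^ (q 0 * q 1) * cellSign q 0) +
      (term ![0, (q 0 : ℤ)] ((-1) ^ (q 0 * q 1) * cellSign q 1) +
        term ![0, -(q 0 : ℤ)] ((-1) ^ (q 0 * q 1) * cellSign q 1)) := by
  have ha : (0 : ℤ) < q 0 := by simpa using NeZero.pos (q 0)
  have hb : (0 : ℤ) < q 1 := by simpa using NeZero.pos (q 1)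
  obtain ⟨A, C, hAC, hf, hg⟩ := h
  have hne : ∀ v : Fin 2 → ℤ, v 0 ≠ 0 → ∀ A : Fin 2 → ℤ, A ≠ A - v := by
    intro v hv A h
    have := congrFun h 0
    rw [Pi.sub_apply] at this
    omega
  have hf' := eq_binomial_of_support (hne _ (by simpa using hb.ne') _) hf
  have hg' := eq_binomial_of_support (hne _ (by simpa using hb.ne') _) hg
  obtain ⟨k0, k1, k2, k3, k4⟩ := coeff_mul_of_segments ha hb hAC hf' hg'
  obtain ⟨h1, h2⟩ := fermiPoly_coeff_vertex q V E 1 (Or.inl rfl)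
  obtain ⟨h3, h4⟩ := fermiPoly_coeff_vertex q V E (-1) (Or.inr rfl)
  rw [one_mul] at h1 h2
  rw [neg_one_mul] at h3 h4
  rw [← hfg] at k1 k2 k3 k4
  have hτ : ∀ j, (-1 : ℂ) ^ (q 0 * q 1) * cellSign q j ≠ 0 := fun j =>
    mul_ne_zero (pow_ne_zero _ (by norm_num)) (cellSign_ne_zero q j)
  rw [h3] at k4
  rw [h1] at k1
  rw [h4] at k2
  rw [h2] at k3
  have hα : f.coeff A ≠ 0 := left_ne_zero_of_mul (k1 ▸ hτ 0)
  have hγ : g.coeff C ≠ 0 := right_ne_zero_of_mul (k1 ▸ hτ 0)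
  have hτ' := cellSign_mul_self q
  refine ⟨?_, ?_, ?_⟩
  · rw [hf', firstFactor]
    rw [add_comm (term ![0, (q 0 : ℤ)] _)]
    -- Pairing both end points of `f` with the same end point of `g` gives two vertex coefficients,
    -- whose ratio is that of the coefficients of `f`.
    refine (associated_binomial (γ := g.coeff (C - ![(q 1 : ℤ), q 0]))
      (τ := (-1) ^ (q 0 * q 1)) (A' := ![(q 1 : ℤ), 0]) (B' := ![0, (q 0 : ℤ)]) ?_ hα
      (right_ne_zero_of_mul (k2 ▸ hτ 1)) (hτ' 1) k2.symm k4.symm).trans ?_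
    · simp
    · rw [add_comm]
  · rw [hg', secondFactor]
    refine associated_binomial (γ := f.coeff (A - ![(q 1 : ℤ), -(q 0 : ℤ)]))
      (τ := (-1) ^ (q 0 * q 1)) ?_ hγ
      (left_ne_zero_of_mul (k3 ▸ hτ 1)) (hτ' 1) ?_ ?_
    · simp
    · rw [mul_comm]; exact k3.symm
    · rw [mul_comm]; exact k4.symm
  · rw [hfg, k0, ← k1, ← k2, ← k3, ← k4]
    abel

include hcop in
lemma fermiPoly_eq_of_not_isIrred (h : ¬ IsIrred (fermiPoly q V E)) :
    fermiPoly q V E = term ![(q 1 : ℤ), 0] ((-1) ^ (q 0 * q 1) * cellSign q 0) +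
      term ![-(q 1 : ℤ), 0] ((-1) ^ (q 0 * q 1) * cellSign q 0) +
      (term ![0, (q 0 : ℤ)] ((-1) ^ (q 0 * q 1) * cellSign q 1) +
        term ![0, -(q 0 : ℤ)] ((-1) ^ (q 0 * q 1) * cellSign q 1)) := by
  obtain ⟨f, g, hf, hg, hfg⟩ := not_not.1 h
  rcases fermiPoly_segmentSupports q hcop V E hfg hf hg with hs | hs
  · exact (fermiPoly_eq_of_segmentSupports q V E hfg hs).2.2
  · exact (fermiPoly_eq_of_segmentSupports q V E (hfg.trans (mul_comm _ _)) hs).2.2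

include hcop in
/-- Reducibility forces the spectral parameter to be the average of the potential. -/
theorem eq_cellAverage_of_not_isIrred (h : ¬ IsIrred (fermiPoly q V E)) : E = cellAverage q V := by
  refine eq_cellAverage_of_sum_eq_zero q V E (sum_eq_zero_of_gaugeMatrix_det q hcop _
    (α := (-1) ^ (q 0 * q 1) * cellSign q 0) (β := (-1) ^ (q 0 * q 1) * cellSign q 1) ?_)
  rw [← powSubst_fermiPoly, fermiPoly_eq_of_not_isIrred q hcop V E h]
  simp only [powSubst_add, powSubst_term]
  congr 3 <;> funext i <;> fin_cases i <;> simp <;> ring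

include hcop in
-- The four vertex coefficients factor because both cell signs square to one.
lemma fermiPoly_eq_mul_factors (h : ¬ IsIrred (fermiPoly q V E)) :
    fermiPoly q V E = term ![-(q 1 : ℤ), -(q 0 : ℤ)] ((-1) ^ (q 0 * q 1) * cellSign q 0) *
      firstFactor q * secondFactor q := by
  rw [fermiPoly_eq_of_not_isIrred q hcop V E h, firstFactor, secondFactor]
  simp only [mul_add, add_mul, term_mul_term, add_zero]
  have h0 := cellSign_mul_self q 0
  have h1 := cellSign_mul_self q 1
  set τ : ℂ := (-1) ^ (q 0 * q 1)
  set ε := cellSign q 0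
  set δ := cellSign q 1
  rw [show τ * ε * ε * ε = τ * ε by linear_combination τ * ε * h0,
    show τ * ε * ε * δ = τ * δ by linear_combination τ * δ * h0,
    show τ * ε * δ * ε = τ * δ by linear_combination τ * δ * h0,
    show τ * ε * δ * δ = τ * ε by linear_combination τ * ε * h1]
  simp
  abel

include hcop in
/-- The irreducible factors of a reducible `𝒫`. -/
theorem associated_of_isIrred_of_dvd (h : ¬ IsIrred (fermiPoly q V E)) {f : LaurentPoly 2}
    (hf : ¬ IsMonomial f) (hirr : IsIrred f) (hdvd : f ∣ fermiPoly q V E) :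
    Associated f (firstFactor q) ∨ Associated f (secondFactor q) := by
  obtain ⟨k, hk⟩ := hdvd
  -- With a unit cofactor, `f` would inherit the factorization of the reducible `𝒫`.
  have hk' : ¬ IsMonomial k := by
    intro hm
    obtain ⟨u, rfl⟩ := hm.isUnit
    obtain ⟨f₀, g₀, hf₀, hg₀, hfg⟩ := not_not.1 h
    have : f = f₀ * (g₀ * ↑u⁻¹) := by
      rw [← mul_assoc, ← hfg, hk, mul_assoc, Units.mul_inv, mul_one]
    rcases hirr.isMonomial_or this with h1 | h1
    · exact hf₀ h1
    · exact hg₀ (isMonomial_of_mul h1)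
  rcases fermiPoly_segmentSupports q hcop V E hk hf hk' with hs | hs
  · exact Or.inl (fermiPoly_eq_of_segmentSupports q V E hk hs).1
  · exact Or.inr (fermiPoly_eq_of_segmentSupports q V E (hk.trans (mul_comm _ _)) hs).2.1

end Main

/-- Zero is `0 * 0`, and zero is not a monomial. -/
lemma IsIrred.ne_zero {f : LaurentPoly 2} (h : IsIrred f) : f ≠ 0 := by
  rintro rfl
  have h0 : ¬ IsMonomial (0 : LaurentPoly 2) := by
    rintro ⟨a, C, hC, h⟩
    have := congrArg (fun P : LaurentPoly 2 => P.coeff a) h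
    simp [coeff_term] at this
    exact hC this.symm
  exact h ⟨0, 0, h0, h0, by simp⟩

/-- A factor of multiplicity one. -/
lemma emultiplicity_eq_one_of_eq_mul {P c f g : LaurentPoly 2} (hP : P = c * f * g)
    (hc : IsMonomial c) (hf : ¬ IsMonomial f) (hfi : IsIrred f) (hgi : IsIrred g)
    (hfg : ¬ Associated f g) : emultiplicity f P = 1 := by
  obtain ⟨u, rfl⟩ := hc.isUnit
  have hf0 := IsIrred.ne_zero hfi
  rw [← Nat.cast_one, emultiplicity_eq_coe]
  refine ⟨⟨u * g, by rw [hP]; ring⟩, ?_⟩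
  -- If the square of `f` divided `P`, then `f` would divide `g`, and irreducibility of `g` would
  -- make them associated.
  rintro ⟨k, hk⟩
  have h1 : (u : LaurentPoly 2) * g = f * k := by
    refine mul_left_cancel₀ hf0 ?_
    linear_combination hk - hP
  have h2 : g = f * (k * ↑u⁻¹) := by
    rw [← mul_assoc, ← h1, mul_comm (u : LaurentPoly 2), mul_assoc, Units.mul_inv, mul_one]
  rcases hgi.isMonomial_or h2 with h3 | h3
  · exact hf h3
  · obtain ⟨v, hv⟩ := h3.isUnit
    exact hfg ⟨v, by rw [hv, h2]⟩

end FermiVariety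

open FermiVariety in
theorem mainTheorem2 (q : Fin 2 → ℕ) (hq : ∀ j, 0 < q j) (hcop : Nat.Coprime (q 0) (q 1))
    (V : (Fin 2 → ℤ) → ℂ) (hV : FermiVariety.IsPeriodic q V) :
    (∀ E : ℂ, E ≠ FermiVariety.cellAverage q V →
      FermiVariety.IsIrred (FermiVariety.fermiPoly q V E)) ∧
    (¬ FermiVariety.IsIrred (FermiVariety.fermiPoly q V (FermiVariety.cellAverage q V)) →
      ∃ f g : FermiVariety.LaurentPoly 2,
        -- `f` and `g` are non-trivial irreducible factors, distinct up to monomials,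
        ¬ FermiVariety.IsMonomial f ∧ FermiVariety.IsIrred f ∧
        ¬ FermiVariety.IsMonomial g ∧ FermiVariety.IsIrred g ∧
        ¬ Associated f g ∧
        -- each of multiplicity one,
        emultiplicity f (FermiVariety.fermiPoly q V (FermiVariety.cellAverage q V)) = 1 ∧
        emultiplicity g (FermiVariety.fermiPoly q V (FermiVariety.cellAverage q V)) = 1 ∧
        -- there are no other ones,
        (∀ h : FermiVariety.LaurentPoly 2, ¬ FermiVariety.IsMonomial h → FermiVariety.IsIrred h →
          h ∣ FermiVariety.fermiPoly q V (FermiVariety.cellAverage q V) →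
          Associated h f ∨ Associated h g) ∧
        -- and they are given explicitly.
        FermiVariety.powSubst q f = FermiVariety.firstProduct q ∧
        FermiVariety.powSubst q g = FermiVariety.secondProduct q ∧
        ∃ K : ℂ, K ≠ 0 ∧
          (-1) ^ (q 0 * q 1) *
              FermiVariety.powSubst q
                (FermiVariety.fermiPoly q V (FermiVariety.cellAverage q V)) =
            FermiVariety.term (fun _ => -((q 0 * q 1 : ℕ) : ℤ)) K *
              FermiVariety.firstProduct q * FermiVariety.secondProduct q) := by
  have : ∀ j, NeZero (q j) := fun j => ⟨(hq j).ne'⟩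
  refine ⟨fun E hE => ?_, fun hred => ?_⟩
  · by_contra h
    exact hE (eq_cellAverage_of_not_isIrred q hcop V E h)
  have hP := fermiPoly_eq_mul_factors q hcop V _ hred
  have hc : IsMonomial (term ![-(q 1 : ℤ), -(q 0 : ℤ)] ((-1) ^ (q 0 * q 1) * cellSign q 0)) :=
    ⟨_, _, mul_ne_zero (pow_ne_zero _ (by norm_num)) (cellSign_ne_zero q 0), rfl⟩
  have hf := firstFactor_not_isMonomial q hq
  have hg := secondFactor_not_isMonomial q hq
  have hfi := firstFactor_isIrred q hcop
  have hgi := secondFactor_isIrred q hcop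
  have hfg := not_associated_factors q hq
  refine ⟨firstFactor q, secondFactor q, hf, hfi, hg, hgi, hfg,
    emultiplicity_eq_one_of_eq_mul hP hc hf hfi hgi hfg,
    emultiplicity_eq_one_of_eq_mul (hP.trans (mul_right_comm _ _ _)) hc hg hgi hfi
      fun h => hfg h.symm,
    fun h hm hi hd => associated_of_isIrred_of_dvd q hcop V _ hred hm hi hd,
    powSubst_firstFactor q hq hcop, powSubst_secondFactor q hq hcop, cellSign q 0,
    cellSign_ne_zero q 0, ?_⟩
  -- The prefactor `(-1) ^ Q` cancels the one in the vertex coefficients, which leaves `K = cellSign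
  -- q 0`.
  rw [hP, powSubst_mul, powSubst_mul, powSubst_firstFactor q hq hcop,
    powSubst_secondFactor q hq hcop, powSubst_term, ← mul_assoc, ← mul_assoc, neg_one_pow_mul_term,
    ← mul_assoc, ← mul_pow, neg_one_mul, neg_neg, one_pow, one_mul]
  congr 3
  funext i
  fin_cases i <;> simp <;> ring
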